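/- **Setting.** Let $d,t\in\mathbb N^+$, let $O$ be a Hermitian $d\times d$ matrix (the observable), and let $C_O=\{V\in \mathrm U(d): VO=OV\}$. All systems $P,I_1,\dots,I_t,O_1,\dots,O_t,F$ are copies of $\mathbb C^d$; $\boldsymbol I=I_1\cdots I_t$, $\boldsymbol O=O_1\cdots O_t$. Write $|U\rangle\!\rangle=\sum_i|i\rangle\otimes U|i\rangle$, and for an operator $C$ on $\mathcal H_P\otimes\mathcal H_{\boldsymbol I}\otimes\mathcal H_{\boldsymbol O}\otimes\mathcal H_F$ let $C*|U\rangle\!\rangle\!\langle\!\langle U|^{\otimes t}=\operatorname{Tr}_{\boldsymbol{IO}}\bigl[C^{T_{\boldsymbol{IO}}}(1_P\otimes|U\rangle\!\rangle\!\langle\!\langle U|^{\otimes t}_{\boldsymbol{IO}}\otimes 1_F)\bigr]$. **The SDP for parallel combs.** Minimise $$f_O(C)=\int_{\mathrm U(d)}\Bigl\|\operatorname{Tr}_F\bigl[S\,(C*|U\rangle\!\rangle\!\langle\!\langle U|^{\otimes t})^{T}S\,(O_F^{T}\otimes 1_P)-|U\rangle\!\rangle\!\langle\!\langle U|_{FP}(O_F^{T}\otimes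 1_P)\bigr]\Bigr\|_F\,d\mu_H(U)$$ ($S$ = the switch exchanging $P$ and $F$, $\mu_H$ = Haar probability measure, $\|\cdot\|_F$ = Frobenius norm) over all operators $C\ge0$ with $\operatorname{Tr}_F C=\operatorname{Tr}_{\boldsymbol OF}C\otimes \frac{1_{\boldsymbol O}}{d^{t}}$, $\operatorname{Tr}_{\boldsymbol{IO}F}C=\operatorname{Tr}_{P\boldsymbol{IO}F}C\otimes\frac{1_P}{d}$ and $\operatorname{Tr}C=d^{t+1}$. **Schur basis.** A Schur basis is a unitary matrix $Q$ with columns $|v_{r,a,\alpha}\rangle=\sum_{i\in[d]^{2t+2}}p^{r,a,\alpha}_i|e_i\rangle$ ($r\in I$, $I$ a finite set, $a\in[\dim V_r]$, $\alpha\in[m_r]$, $m_r\ge1$) such that $Q^\dagger\,(U^{\otimes(t+1)}\otimes V^{\otimes t}\otimes W)\,Q=\bigoplus_{r\in I}\rho^r(U,V,W)\otimes 1_{m_r}$ for all $(U,V,W)\in \mathrm U(d)\times C_O\times C_O$, where the $\rho^r$ on $V_r$ are irreducible and pairwise inequivalent. Let $\sigma\in S_{2t+2}$ take the ordering $(P,I_1,\dots,I_t,O_1,\dots,O_t,F)$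 to an ordering $(P,O\text{'s},I\text{'s},F)$ (any order inside the groups), and let $P_\sigma(i_1,\dots,i_{2t+2})=(i_{\sigma^{-1}(1)},\dots,i_{\sigma^{-1}(2t+2)})$, $P_\sigma|e_i\rangle=|e_{P_\sigma(i)}\rangle$. **The block-diagonal SDP.** Its variables are matrices $C^{(r)}=[c^{(r)}_{\alpha,\beta}]\in\mathbb C^{m_r\times m_r}$, $r\in I$. For $K\in\{t+1,2t+1\}$ split $i\in[d]^{2t+2}$ into $u=(i_{\mathbf{R}_K},i_{2t+1-K})\in[d]^{2t+2-K}\times[d]^{2t+1-K}$ (its first $2t+2-K$ entries and the next $2t+1-K$ entries) and the last $2K-2t-1$ entries $y$. Put $\widetilde{\operatorname{Supp}}{}^{\sigma}_{r,K}(u)=\{(a,y):\exists\alpha,\ p^{r,a,\alpha}_{P_\sigma(u,y)}\ne0\}$, $$[\widetilde M^{r,\sigma}_K(u,v)]_{\beta,\alpha}=\sum_{(a,y)\in\widetilde{\operatorname{Supp}}{}^{\sigma}_{r,K}(u)\cap\widetilde{\operatorname{Supp}}{}^{\sigma}_{r,K}(v)}p^{r,a,\alpha}_{P_\sigma(u,y)}\bigl(p^{r,a,\beta}_{P_\sigma(v,y)}\bigr)^{*},$$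 (an empty sum being $0$), and let $\widetilde S^\sigma_K$ be the set of all $(u,v)$ such that $\widetilde{\operatorname{Supp}}{}^{\sigma}_{r,K}(u)\cap\widetilde{\operatorname{Supp}}{}^{\sigma}_{r,K}(v)\neq\emptyset$ for some $r\in I$. Further, for $i_1,j_1\in[d]$ let $$[\widetilde M^{r,\sigma}_{U,O}(j_1,i_1)]_{\beta,\alpha}=\sum_{a}\ \sum_{i_2,\dots,i_{2t+2}}\ \sum_{j_2,\dots,j_{2t+2}}p^{r,a,\alpha}_{P_\sigma(i)}\bigl(p^{r,a,\beta}_{P_\sigma(j)}\bigr)^{*}\prod_{l=2}^{t+1}U_{i_{t+l},i_l}\,(U_{j_{t+l},j_l})^{*}\,\operatorname{Tr}\bigl(|e_{j_{2t+2}}\rangle\langle e_{i_{2t+2}}|O^{T}\bigr),$$ the sums running over the labels with $p^{r,a,\alpha}_{P_\sigma(i)}\neq0$ and $p^{r,a,\beta}_{P_\sigma(j)}\ne0$. The block-diagonal SDP is: minimise $$g(\{C^{(r)}\})=\int_{\mathrm U(d)}\Bigl\|\sum_{r\in I}\sum_{i_1,j_1\in[d]}\operatorname{Tr}\bigl[C^{(r)}\widetilde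 M^{r,\sigma}_{U,O}(j_1,i_1)\bigr]|e_{j_1}\rangle\langle e_{i_1}|-UOU^\dagger\Bigr\|_F\,d\mu_H(U)$$ subject to * $\sum_r\operatorname{Tr}[C^{(r)}\widetilde M^{r,\sigma}_{t+1}(i_{\mathbf R},i_t,j_{\mathbf R},j_t)]=\frac{\delta_{i_t,j_t}}{d^t}\sum_{k\in[d]^t}\sum_r\operatorname{Tr}[C^{(r)}\widetilde M^{r,\sigma}_{t+1}(i_{\mathbf R},k,j_{\mathbf R},k)]$ for all $((i_{\mathbf R},i_t),(j_{\mathbf R},j_t))\in\widetilde S^\sigma_{t+1}$, where $i_{\mathbf R},j_{\mathbf R}\in[d]^{t+1}$ and $i_t,j_t\in[d]^t$; * $\sum_r\operatorname{Tr}[C^{(r)}\widetilde M^{r,\sigma}_{2t+1}(i,j)]=\frac{\delta_{i,j}}{d}\sum_{k\in[d]}\sum_r\operatorname{Tr}[C^{(r)}\widetilde M^{r,\sigma}_{2t+1}(k,k)]$ for all $(i,j)\in\widetilde S^\sigma_{2t+1}$, where $i,j\in[d]$; * $\sum_r\dim(V_r)\operatorname{Tr}(C^{(r)})=d^{t+1}$;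 * $C^{(r)}\ge0$ for all $r\in I$. **Theorem.** A Schur basis exists. For every Schur basis and every such $\sigma$ the two SDPs are equivalent, in the following sense. 1. The linear map $\{C^{(r)}\}\mapsto C$ given by $P_\sigma CP_\sigma^{-1}=\sum_r\sum_{\alpha,\beta}c^{(r)}_{\alpha,\beta}\sum_a|v_{r,a,\alpha}\rangle\langle v_{r,a,\beta}|$ restricts to a bijection from the feasible set of the block-diagonal SDP onto the set of those feasible points $C$ of the SDP for parallel combs that satisfy $[C,U\otimes V^{\otimes t}\otimes U^{\otimes t}\otimes W]=0$ for all $U\in\mathrm U(d)$, $V,W\in C_O$. 2. For all $\{C^{(r)}\}$ and the corresponding $C$: $\operatorname{Tr}C=\sum_r\dim(V_r)\operatorname{Tr}(C^{(r)})$ and $f_O(C)=g(\{C^{(r)}\})$. 3. For every feasible $C$ of the SDP for parallel combs there is a feasible $C'$ with the above symmetry and $f_O(C')\le f_O(C)$. 4. Both minima are attained, and they are equal. -/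

import Mathlib

open scoped Kronecker ComplexOrder

noncomputable section

namespace ShadowComb

/-! ### The unitary group, its Haar measure, and the centralizer of an observable -/

/-- The unitary group `U(d)`. -/
abbrev UGroup (d : ℕ) := Matrix.unitaryGroup (Fin d) ℂ

/-- `U(d)` carries its Borel `σ`-algebra. -/
instance instMeasurableSpaceUGroup (d : ℕ) : MeasurableSpace (UGroup d) := borel _

instance instBorelSpaceUGroup (d : ℕ) : BorelSpace (UGroup d) := ⟨rfl⟩

instance instCompactSpaceUGroup (d : ℕ) : CompactSpace (UGroup d) := by
  apply isCompact_iff_compactSpace.mp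
  have hball : IsCompact (Set.pi Set.univ (fun _ : Fin d => Set.pi Set.univ
      (fun _ : Fin d => Metric.closedBall (0 : ℂ) 1))) :=
    isCompact_univ_pi fun _ => isCompact_univ_pi fun _ => isCompact_closedBall 0 1
  have hclosed : IsClosed ((Matrix.unitaryGroup (Fin d) ℂ : Submonoid (Matrix (Fin d) (Fin d) ℂ)) :
      Set (Matrix (Fin d) (Fin d) ℂ)) := by
    have h : ((Matrix.unitaryGroup (Fin d) ℂ : Submonoid (Matrix (Fin d) (Fin d) ℂ)) :
        Set (Matrix (Fin d) (Fin d) ℂ)) = {A | A * star A = 1} := by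
      ext A
      exact Matrix.mem_unitaryGroup_iff
    rw [h]
    exact isClosed_eq (by fun_prop) continuous_const
  refine hball.of_isClosed_subset hclosed ?_
  intro A hA
  simp only [Set.mem_pi, Set.mem_univ, true_implies, mem_closedBall_zero_iff]
  intro i j
  exact entry_norm_bound_of_unitary hA i j

/-- The Haar probability measure on `U(d)`. -/
def haarU (d : ℕ) : MeasureTheory.Measure (UGroup d) :=
  MeasureTheory.Measure.haarMeasure ⊤

/-- `C_O`: the centralizer of the observable `O` in `U(d)`. -/
def centralizerU {d : ℕ} (O : Matrix (Fin d) (Fin d) ℂ) : Subgroup (UGroup d) where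
  carrier := {U | (U : Matrix (Fin d) (Fin d) ℂ) * O = O * U}
  mul_mem' := by
    intro U V hU hV
    simp only [Set.mem_ofPred_eq] at *
    rw [Submonoid.coe_mul, mul_assoc, hV, ← mul_assoc, hU, mul_assoc]
  one_mem' := by simp
  inv_mem' := by
    intro U hU
    simp only [Set.mem_ofPred_eq] at *
    have h1 : ((U⁻¹ : UGroup d) : Matrix (Fin d) (Fin d) ℂ) * U = 1 := by
      rw [← Submonoid.coe_mul, inv_mul_cancel, Submonoid.coe_one]
    have h2 : (U : Matrix (Fin d) (Fin d) ℂ) * ((U⁻¹ : UGroup d) : Matrix (Fin d) (Fin d) ℂ) = 1 := by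
      rw [← Submonoid.coe_mul, mul_inv_cancel, Submonoid.coe_one]
    calc ((U⁻¹ : UGroup d) : Matrix (Fin d) (Fin d) ℂ) * O
        = (U⁻¹ : UGroup d) * O * (U * (U⁻¹ : UGroup d)) := by rw [h2, mul_one]
      _ = (U⁻¹ : UGroup d) * (U * O) * (U⁻¹ : UGroup d) := by rw [hU]; simp only [mul_assoc]
      _ = ((U⁻¹ : UGroup d) * U) * O * (U⁻¹ : UGroup d) := by simp only [mul_assoc]
      _ = O * (U⁻¹ : UGroup d) := by rw [h1, one_mul]

/-! ### The SDP for parallel combs -/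

/-- Labels of the computational basis of `H_P ⊗ H_I ⊗ H_O ⊗ H_F`, where
`H_I = H_{I_1} ⊗ ⋯ ⊗ H_{I_t}`, `H_O = H_{O_1} ⊗ ⋯ ⊗ H_{O_t}` and every factor is `ℂ^d`:
a tuple `(p, i, o, f)`. -/
abbrev Idx (d t : ℕ) := Fin d × (Fin t → Fin d) × (Fin t → Fin d) × Fin d

/-- Operators on `H_P ⊗ H_I ⊗ H_O ⊗ H_F`. -/
abbrev CombOp (d t : ℕ) := Matrix (Idx d t) (Idx d t) ℂ

/-- Tensor product `A_1 ⊗ ⋯ ⊗ A_n` of operators on `ℂ^d`, as an operator on `(ℂ^d)^{⊗ n}`. -/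
def tensorOp {d n : ℕ} (A : Fin n → Matrix (Fin d) (Fin d) ℂ) :
    Matrix (Fin n → Fin d) (Fin n → Fin d) ℂ :=
  Matrix.of fun x y => ∏ k, A k (x k) (y k)

/-- `Tr_F`, an operator on `(H_P ⊗ H_I) ⊗ H_O`. -/
def trF {d t : ℕ} (C : CombOp d t) :
    Matrix ((Fin d × (Fin t → Fin d)) × (Fin t → Fin d))
      ((Fin d × (Fin t → Fin d)) × (Fin t → Fin d)) ℂ :=
  Matrix.of fun x y => ∑ f, C (x.1.1, x.1.2, x.2, f) (y.1.1, y.1.2, y.2, f)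

/-- `Tr_{OF}`, an operator on `H_P ⊗ H_I`. -/
def trOF {d t : ℕ} (C : CombOp d t) :
    Matrix (Fin d × (Fin t → Fin d)) (Fin d × (Fin t → Fin d)) ℂ :=
  Matrix.of fun x y => ∑ o, ∑ f, C (x.1, x.2, o, f) (y.1, y.2, o, f)

/-- `Tr_{IOF}`, an operator on `H_P`. -/
def trIOF {d t : ℕ} (C : CombOp d t) : Matrix (Fin d) (Fin d) ℂ :=
  Matrix.of fun p q => ∑ i, ∑ o, ∑ f, C (p, i, o, f) (q, i, o, f)

/-- The constraints of the SDP for `t`-slot parallel combs: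
`C ≥ 0`, `Tr_F C = Tr_{OF} C ⊗ 1_O / d_O`, `Tr_{IOF} C = Tr_{PIOF} C ⊗ 1_P / d_P` and
`Tr C = d_P d_O`, where `d_P = d` and `d_O = d ^ t`. -/
structure Feasible {d t : ℕ} (C : CombOp d t) : Prop where
  posSemidef : C.PosSemidef
  trF_eq : trF C = trOF C ⊗ₖ (((d : ℂ) ^ t)⁻¹ • (1 : Matrix (Fin t → Fin d) (Fin t → Fin d) ℂ))
  trIOF_eq : trIOF C = C.trace • ((d : ℂ)⁻¹ • (1 : Matrix (Fin d) (Fin d) ℂ))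
  trace_eq : C.trace = (d : ℂ) * (d : ℂ) ^ t

/-- The Choi vector `|U⟩⟩ = ∑ i, |i⟩ ⊗ U|i⟩`. -/
def choiVec {d : ℕ} (U : Matrix (Fin d) (Fin d) ℂ) : Fin d × Fin d → ℂ :=
  fun x => U x.2 x.1

/-- The Choi operator `|U⟩⟩⟨⟨U|` on `H_in ⊗ H_out`. -/
def choiOp {d : ℕ} (U : Matrix (Fin d) (Fin d) ℂ) : Matrix (Fin d × Fin d) (Fin d × Fin d) ℂ :=
  Matrix.vecMulVec (choiVec U) (star (choiVec U))

/-- `|U⟩⟩⟨⟨U|^{⊗ t}` with the tensor factors in the order `(I_1, …, I_t, O_1, …, O_t)`. -/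
def choiPow {d : ℕ} (t : ℕ) (U : Matrix (Fin d) (Fin d) ℂ) :
    Matrix ((Fin t → Fin d) × (Fin t → Fin d)) ((Fin t → Fin d) × (Fin t → Fin d)) ℂ :=
  Matrix.of fun x y => ∏ k, choiOp U (x.1 k, x.2 k) (y.1 k, y.2 k)

/-- Partial transposition `C^{T_{IO}}`. -/
def transposeIO {d t : ℕ} (C : CombOp d t) : CombOp d t :=
  Matrix.of fun x y =>
    C (x.1, y.2.1, y.2.2.1, x.2.2.2) (y.1, x.2.1, x.2.2.1, y.2.2.2)

/-- `1_P ⊗ Y ⊗ 1_F` for an operator `Y` on `H_I ⊗ H_O`. -/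
def extendIO {d t : ℕ}
    (Y : Matrix ((Fin t → Fin d) × (Fin t → Fin d)) ((Fin t → Fin d) × (Fin t → Fin d)) ℂ) :
    CombOp d t :=
  Matrix.of fun x y =>
    (1 : Matrix (Fin d) (Fin d) ℂ) x.1 y.1 * Y (x.2.1, x.2.2.1) (y.2.1, y.2.2.1) *
      (1 : Matrix (Fin d) (Fin d) ℂ) x.2.2.2 y.2.2.2

/-- `Tr_{IO}`, an operator on `H_P ⊗ H_F`. -/
def trIO {d t : ℕ} (C : CombOp d t) : Matrix (Fin d × Fin d) (Fin d × Fin d) ℂ :=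
  Matrix.of fun x y => ∑ i, ∑ o, C (x.1, i, o, x.2) (y.1, i, o, y.2)

/-- The link product `C * Y = Tr_{IO}[C^{T_{IO}} (1_P ⊗ Y ⊗ 1_F)]`. -/
def linkProduct {d t : ℕ} (C : CombOp d t)
    (Y : Matrix ((Fin t → Fin d) × (Fin t → Fin d)) ((Fin t → Fin d) × (Fin t → Fin d)) ℂ) :
    Matrix (Fin d × Fin d) (Fin d × Fin d) ℂ :=
  trIO (transposeIO C * extendIO Y)

/-- Conjugation `X ↦ F X F` by the switch operator, exchanging the two tensor factors. -/
def switchConj {d : ℕ} (X : Matrix (Fin d × Fin d) (Fin d × Fin d) ℂ) :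
    Matrix (Fin d × Fin d) (Fin d × Fin d) ℂ :=
  X.submatrix Prod.swap Prod.swap

/-- Partial trace over the first tensor factor. -/
def trFst {d : ℕ} (X : Matrix (Fin d × Fin d) (Fin d × Fin d) ℂ) : Matrix (Fin d) (Fin d) ℂ :=
  Matrix.of fun p q => ∑ f, X (f, p) (f, q)

/-- The Frobenius norm. -/
def frobNorm {d : ℕ} (A : Matrix (Fin d) (Fin d) ℂ) : ℝ :=
  Real.sqrt (∑ i, ∑ j, ‖A i j‖ ^ 2)

/-- The objective function of the SDP,
`∫ ‖ Tr_F[ F (C * |U⟩⟩⟨⟨U|^{⊗ t})ᵀ F (O_Fᵀ ⊗ 1_P) - |U⟩⟩⟨⟨U|_{FP} (O_Fᵀ ⊗ 1_P) ] ‖_F dμ_H(U)`. -/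
def objective {d t : ℕ} (O : Matrix (Fin d) (Fin d) ℂ) (C : CombOp d t) : ℝ :=
  ∫ U : UGroup d, frobNorm (trFst
    (switchConj (linkProduct C (choiPow t (U : Matrix (Fin d) (Fin d) ℂ))).transpose *
        (O.transpose ⊗ₖ (1 : Matrix (Fin d) (Fin d) ℂ)) -
      choiOp (U : Matrix (Fin d) (Fin d) ℂ) *
        (O.transpose ⊗ₖ (1 : Matrix (Fin d) (Fin d) ℂ)))) ∂(haarU d)

/-- The symmetry `[C, U ⊗ V^{⊗ t} ⊗ U^{⊗ t} ⊗ W] = 0` for all `U ∈ U(d)` and `V, W ∈ C_O`. -/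
def Symmetric {d t : ℕ} (O : Matrix (Fin d) (Fin d) ℂ) (C : CombOp d t) : Prop :=
  ∀ (U : UGroup d) (V W : centralizerU O),
    Commute C ((U : Matrix (Fin d) (Fin d) ℂ) ⊗ₖ
      (tensorOp (fun _ : Fin t => ((V : UGroup d) : Matrix (Fin d) (Fin d) ℂ)) ⊗ₖ
        (tensorOp (fun _ : Fin t => (U : Matrix (Fin d) (Fin d) ℂ)) ⊗ₖ
          ((W : UGroup d) : Matrix (Fin d) (Fin d) ℂ))))

/-! ### Grouping of the tensor factors and Schur bases -/

/-- The computational basis label of `(ℂ^d)^{⊗ (2t+2)}` obtained by listing the systems in the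
order `(P, I_1, …, I_t, O_1, …, O_t, F)`; positions are counted from `0`. -/
def flatten {d t : ℕ} (x : Idx d t) : Fin (2 * t + 2) → Fin d := fun k =>
  if k.1 = 0 then x.1
  else if h : k.1 - 1 < t then x.2.1 ⟨k.1 - 1, h⟩
  else if h : k.1 - 1 - t < t then x.2.2.1 ⟨k.1 - 1 - t, h⟩
  else x.2.2.2

/-- `P_σ (i_1, …, i_n) = (i_{σ⁻¹(1)}, …, i_{σ⁻¹(n)})`. -/
def permIdx {d n : ℕ} (σ : Equiv.Perm (Fin n)) (x : Fin n → Fin d) : Fin n → Fin d :=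
  fun k => x (σ.symm k)

/-- `σ` maps the ordering `(P, I_1, …, I_t, O_1, …, O_t, F)` to an ordering
`(P, O_1, …, O_t, I_1, …, I_t, F)`; the order inside the two groups is arbitrary. -/
structure IsGrouping {t : ℕ} (σ : Equiv.Perm (Fin (2 * t + 2))) : Prop where
  map_P : ∀ k, k.1 = 0 → (σ k).1 = 0
  map_I : ∀ k, 1 ≤ k.1 → k.1 ≤ t → t + 1 ≤ (σ k).1 ∧ (σ k).1 ≤ 2 * t
  map_O : ∀ k, t + 1 ≤ k.1 → k.1 ≤ 2 * t → 1 ≤ (σ k).1 ∧ (σ k).1 ≤ t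
  map_F : ∀ k, k.1 = 2 * t + 1 → (σ k).1 = 2 * t + 1

/-- The group `U(d) × C_O × C_O`. -/
abbrev SymGroup {d : ℕ} (O : Matrix (Fin d) (Fin d) ℂ) :=
  UGroup d × centralizerU O × centralizerU O

/-- `ρ_{O,t}(U, V, W) = U^{⊗ (t+1)} ⊗ V^{⊗ t} ⊗ W` on `(ℂ^d)^{⊗ (2t+2)}`. -/
def rhoO {d : ℕ} (t : ℕ) (O : Matrix (Fin d) (Fin d) ℂ) (g : SymGroup O) :
    Matrix (Fin (2 * t + 2) → Fin d) (Fin (2 * t + 2) → Fin d) ℂ :=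
  tensorOp fun k =>
    if k.1 ≤ t then (g.1 : Matrix (Fin d) (Fin d) ℂ)
    else if k.1 ≤ 2 * t then ((g.2.1 : UGroup d) : Matrix (Fin d) (Fin d) ℂ)
    else ((g.2.2 : UGroup d) : Matrix (Fin d) (Fin d) ℂ)

/-- A Schur matrix for `ρ_{O,t}`: a unitary matrix `Q` with columns `|v_{r,a,α}⟩`, `r ∈ I`,
`a ∈ [dim V_r]`, `α ∈ [m_r]`, such that `Q† ρ_{O,t}(g) Q = ⨁ r, ρ^r(g) ⊗ 1_{m_r}`, where the `ρ^r`
are irreducible and pairwise inequivalent and every multiplicity `m_r` is positive. -/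
structure SchurBasis {d : ℕ} (t : ℕ) (O : Matrix (Fin d) (Fin d) ℂ) where
  I : Type
  fintypeI : Fintype I
  decEqI : DecidableEq I
  dim : I → ℕ
  mult : I → ℕ
  mult_pos : ∀ r, 0 < mult r
  irrep : ∀ r, Representation ℂ (SymGroup O) (Fin (dim r) → ℂ)
  irreducible : ∀ r, (irrep r).IsIrreducible
  inequivalent : ∀ r s, r ≠ s → IsEmpty ((irrep r).Equiv (irrep s))
  Q : Matrix (Fin (2 * t + 2) → Fin d) (Σ r, Fin (dim r) × Fin (mult r)) ℂ
  conjTranspose_mul_self : Q.conjTranspose * Q = 1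
  mul_conjTranspose_self : Q * Q.conjTranspose = 1
  block : ∀ g, Q.conjTranspose * rhoO t O g * Q =
    Matrix.blockDiagonal' fun r =>
      LinearMap.toMatrix' (irrep r g) ⊗ₖ (1 : Matrix (Fin (mult r)) (Fin (mult r)) ℂ)

attribute [instance] SchurBasis.fintypeI SchurBasis.decEqI

namespace SchurBasis

variable {d t : ℕ} {O : Matrix (Fin d) (Fin d) ℂ} (B : SchurBasis t O)

/-- The variables `C^{(r)}`, `r ∈ I`, of the block-diagonal SDP. -/
abbrev Blocks := ∀ r : B.I, Matrix (Fin (B.mult r)) (Fin (B.mult r)) ℂ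

/-- The vector `|v_{r,a,α}⟩`. -/
def vec (r : B.I) (a : Fin (B.dim r)) (α : Fin (B.mult r)) : (Fin (2 * t + 2) → Fin d) → ℂ :=
  fun x => B.Q x ⟨r, (a, α)⟩

/-- `∑ r, ∑ α β, c^{(r)}_{α,β} ∑ a, |v_{r,a,α}⟩⟨v_{r,a,β}|`. -/
def groupedOp (c : B.Blocks) : Matrix (Fin (2 * t + 2) → Fin d) (Fin (2 * t + 2) → Fin d) ℂ :=
  ∑ r, ∑ α, ∑ β, c r α β • ∑ a, Matrix.vecMulVec (B.vec r a α) (star (B.vec r a β))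

/-- The operator `C` with `P_σ C P_σ⁻¹ = groupedOp c`. (As `P_σ |x⟩ = |P_σ x⟩`, the
`(P_σ x, P_σ y)` entry of `P_σ C P_σ⁻¹` is the `(x, y)` entry of `C`.) -/
def assemble (σ : Equiv.Perm (Fin (2 * t + 2))) (c : B.Blocks) : CombOp d t :=
  Matrix.of fun x y => B.groupedOp c (permIdx σ (flatten x)) (permIdx σ (flatten y))

/-- The coefficient `p^{r,a,α}_{P_σ(p, i, o, f)}`. -/
def coeff (σ : Equiv.Perm (Fin (2 * t + 2))) (r : B.I) (a : Fin (B.dim r)) (α : Fin (B.mult r))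
    (x : Idx d t) : ℂ :=
  B.vec r a α (permIdx σ (flatten x))

/-! The sets and matrices below depend on a splitting of the list of systems into a part `R` that
is kept, a part `X` on which the result is constrained to be maximally mixed, and a part `Y` that
is traced out. It is given by the function `join` that puts the three pieces of a label together. -/

section Split

variable {R X Y : Type} [Fintype Y] (join : R → X → Y → Idx d t) (σ : Equiv.Perm (Fin (2 * t + 2)))

/-- The set of all `(a, y)` with `p^{r,a,α}_{P_σ(u, y)} ≠ 0` for some `α`. -/
def supp (r : B.I) (u : R × X) : Set (Fin (B.dim r) × Y) :=
  {ay | ∃ α, B.coeff σ r ay.1 α (join u.1 u.2 ay.2) ≠ 0}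

/-- The labels `u` with non-empty support in the block `r`. -/
def suppIdx (r : B.I) : Set (R × X) :=
  {u | (B.supp join σ r u).Nonempty}

open Classical in
/-- The matrix `M̃^{r,σ}(u, v)`, with rows labelled by `β` and columns by `α`. -/
def tildeM (r : B.I) (u v : R × X) : Matrix (Fin (B.mult r)) (Fin (B.mult r)) ℂ :=
  Matrix.of fun β α =>
    ∑ ay : Fin (B.dim r) × Y with ay ∈ B.supp join σ r u ∩ B.supp join σ r v,
      B.coeff σ r ay.1 α (join u.1 u.2 ay.2) * star (B.coeff σ r ay.1 β (join v.1 v.2 ay.2))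

/-- The set `S̃^σ` of pairs of labels whose supports meet in some block. -/
def tildeS : Set ((R × X) × (R × X)) :=
  ⋃ r : B.I, {uv | (uv.1 ∈ B.suppIdx join σ r ∧ uv.2 ∈ B.suppIdx join σ r) ∧
    (B.supp join σ r uv.1 ∩ B.supp join σ r uv.2).Nonempty}

end Split

/-- The splitting for `K = t + 1`: keep `P, I`, constrain `O`, trace out `F`. -/
def joinO (pi : Fin d × (Fin t → Fin d)) (o : Fin t → Fin d) (f : Fin d) : Idx d t :=
  (pi.1, pi.2, o, f)

/-- The splitting for `K = 2t + 1`: keep `P`, trace out `I, O, F`; the middle part is empty. -/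
def joinP (p : Fin d) (_ : Unit) (y : (Fin t → Fin d) × (Fin t → Fin d) × Fin d) : Idx d t :=
  (p, y)

/-- The labels `(i_2, …, i_{2t+2})` with `p^{r,a,α}_{P_σ(i_1, i_2, …, i_{2t+2})} ≠ 0`. -/
def nonzeroIdx (σ : Equiv.Perm (Fin (2 * t + 2))) (r : B.I) (a : Fin (B.dim r))
    (α : Fin (B.mult r)) (p : Fin d) : Set ((Fin t → Fin d) × (Fin t → Fin d) × Fin d) :=
  {y | B.coeff σ r a α (p, y) ≠ 0}

open Classical in
/-- The matrix `M̃_{U,O}^{r,σ}(q, p)` for basis labels `q = j_1` and `p = i_1`, with rows labelled by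
`β` and columns by `α`. Here `x = (i_2, …, i_{2t+2})` and `y = (j_2, …, j_{2t+2})`, split into their
`I`, `O` and `F` parts. -/
def tildeMU (σ : Equiv.Perm (Fin (2 * t + 2))) (U : Matrix (Fin d) (Fin d) ℂ) (r : B.I)
    (q p : Fin d) : Matrix (Fin (B.mult r)) (Fin (B.mult r)) ℂ :=
  Matrix.of fun β α =>
    ∑ a : Fin (B.dim r),
      ∑ x : (Fin t → Fin d) × (Fin t → Fin d) × Fin d with x ∈ B.nonzeroIdx σ r a α p,
        ∑ y : (Fin t → Fin d) × (Fin t → Fin d) × Fin d with y ∈ B.nonzeroIdx σ r a β q,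
          B.coeff σ r a α (p, x) * star (B.coeff σ r a β (q, y)) *
            (∏ l, U (x.2.1 l) (x.1 l) * star (U (y.2.1 l) (y.1 l))) *
            (Matrix.single y.2.2 x.2.2 (1 : ℂ) * O.transpose).trace

/-- The constraints of the block-diagonal SDP. -/
structure ReducedFeasible (σ : Equiv.Perm (Fin (2 * t + 2))) (c : B.Blocks) : Prop where
  constraint_O : ∀ u v, (u, v) ∈ B.tildeS joinO σ →
    ∑ r, (c r * B.tildeM joinO σ r u v).trace =
      (if u.2 = v.2 then 1 else 0) / (d : ℂ) ^ t *
        ∑ k, ∑ r, (c r * B.tildeM joinO σ r (u.1, k) (v.1, k)).trace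
  constraint_P : ∀ i j, ((i, ()), (j, ())) ∈ B.tildeS joinP σ →
    ∑ r, (c r * B.tildeM joinP σ r (i, ()) (j, ())).trace =
      (if i = j then 1 else 0) / (d : ℂ) *
        ∑ k, ∑ r, (c r * B.tildeM joinP σ r (k, ()) (k, ())).trace
  trace_eq : ∑ r, (B.dim r : ℂ) * (c r).trace = (d : ℂ) ^ (t + 1)
  posSemidef : ∀ r, (c r).PosSemidef

/-- The objective function of the block-diagonal SDP. -/
def reducedObjective (σ : Equiv.Perm (Fin (2 * t + 2))) (c : B.Blocks) : ℝ :=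
  ∫ U : UGroup d, frobNorm
    ((∑ r, ∑ p, ∑ q, (c r * B.tildeMU σ (U : Matrix (Fin d) (Fin d) ℂ) r q p).trace •
        Matrix.single q p (1 : ℂ)) -
      (U : Matrix (Fin d) (Fin d) ℂ) * O * star (U : Matrix (Fin d) (Fin d) ℂ)) ∂(haarU d)

end SchurBasis

end ShadowComb

end

/-!
The operators `A ⊗ V^{⊗ t} ⊗ A^{⊗ t} ⊗ W` with `A ∈ U(d)` and `V, W ∈ C_O` act on combs by
conjugation. This action preserves the constraints of the parallel-comb program
(`Feasible.conj_localOp`), and the objective is invariant: conjugation turns the integrand at `U`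
into the integrand at `Aᵀ U V`, up to a unitary conjugation under the Frobenius norm, and the Haar
measure is invariant on both sides (`objective_conj_localOp`). The objective is convex and
continuous, and the feasible set is convex and compact, so the feasible points at least as good as
a given one form a compact convex invariant set. Its element of smallest Hilbert–Schmidt norm is
unique, hence symmetric (`exists_symmetric_le`), and it suffices to minimise over symmetric combs.

After the regrouping of the systems by `σ`, symmetry of `C` means that it commutes with the
representation `ρ_{O,t}`. By Schur's lemma the commutant in a Schur basis consists of the matrices
`⨁ r, 1_{V_r} ⊗ C^{(r)}` (`SchurBasis.exists_groupedOp_eq`), which gives the bijection and the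
statements on traces and positivity. The numbers `∑ r, Tr[C^{(r)} M̃^{(r)}(u, v)]` are entries of
partial traces of `C` (`SchurBasis.sum_trace_mul_tildeM`). The reduced constraints are demanded
only for pairs in `S̃`; for the others the left-hand side vanishes, and
`eq_average_of_eq_average_on` shows that the right-hand side then vanishes as well, so that no
constraint is lost (`SchurBasis.feasible_assemble_iff`).

A Schur basis exists because a maximal orthogonal family of irreducible constituents of a unitary
representation is complete (`exists_orthogonalFrames`), and equivalent constituents are equivalent
through a unitary (`IrrepFrame.exists_transport`).
-/

namespace ShadowComb

/-! ### Regrouping of the tensor factors -/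

section Index

variable {d t : ℕ}

lemma flatten_P (x : Idx d t) : flatten x ⟨0, by omega⟩ = x.1 := by simp [flatten]

lemma flatten_I (x : Idx d t) (j : Fin t) : flatten x ⟨1 + j, by omega⟩ = x.2.1 j := by
  simp [flatten]

lemma flatten_O (x : Idx d t) (j : Fin t) : flatten x ⟨1 + t + j, by omega⟩ = x.2.2.1 j := by
  have h : 1 + t + (j : ℕ) - 1 = t + j := by omega
  simp [flatten, h]

lemma flatten_F (x : Idx d t) : flatten x ⟨2 * t + 1, by omega⟩ = x.2.2.2 := by
  have h : ¬ (2 * t < t) := by omega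
  have h' : ¬ (2 * t - t < t) := by omega
  simp [flatten, h, h']

lemma flatten_injective : Function.Injective (flatten : Idx d t → _) := by
  intro x y h
  refine Prod.ext ?_ (Prod.ext (funext fun j => ?_) (Prod.ext (funext fun j => ?_) ?_))
  · rw [← flatten_P x, h, flatten_P]
  · rw [← flatten_I x, h, flatten_I]
  · rw [← flatten_O x, h, flatten_O]
  · rw [← flatten_F x, h, flatten_F]

/-- The bijection `x ↦ P_σ x` from labels `(p, i, o, f)` to labels of `(ℂ^d)^{⊗ (2t+2)}`. -/
noncomputable def relabel (σ : Equiv.Perm (Fin (2 * t + 2))) :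
    Idx d t ≃ (Fin (2 * t + 2) → Fin d) :=
  Equiv.ofBijective (fun x => permIdx σ (flatten x)) <| by
    have hinj : Function.Injective fun x : Idx d t => permIdx σ (flatten x) := by
      intro x y h
      refine flatten_injective (funext fun k => ?_)
      simpa [permIdx] using congrFun h (σ k)
    refine (Fintype.bijective_iff_injective_and_card _).2 ⟨hinj, ?_⟩
    simp only [Fintype.card_prod, Fintype.card_fin, Fintype.card_pi, Finset.prod_const,
      Finset.card_univ]
    ring

@[simp] lemma relabel_apply (σ : Equiv.Perm (Fin (2 * t + 2))) (x : Idx d t) :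
    relabel σ x = permIdx σ (flatten x) := rfl

/-- A product over the `2t+2` systems, split into the groups `P`, `I`, `O` and `F`. -/
lemma prod_systems {M : Type*} [CommMonoid M] (f : Fin (2 * t + 2) → M) :
    ∏ k, f k = f ⟨0, by omega⟩ * ((∏ j : Fin t, f ⟨1 + j, by omega⟩) *
      ((∏ j : Fin t, f ⟨1 + t + j, by omega⟩) * f ⟨2 * t + 1, by omega⟩)) := by
  let g : ℕ → M := fun k => if h : k < 2 * t + 2 then f ⟨k, h⟩ else 1
  have hg : ∀ k (h : k < 2 * t + 2), f ⟨k, h⟩ = g k := fun k h => by simp [g, h]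
  have h1 : ∏ k, f k = ∏ k ∈ Finset.range (1 + t + t + 1), g k := by
    rw [show 1 + t + t + 1 = 2 * t + 2 by omega, ← Fin.prod_univ_eq_prod_range g]
    exact Finset.prod_congr rfl fun k _ => hg k k.2
  rw [h1, Finset.prod_range_succ, Finset.prod_range_add, Finset.prod_range_add,
    Finset.prod_range_one, ← Fin.prod_univ_eq_prod_range (fun j => g (1 + j)),
    ← Fin.prod_univ_eq_prod_range (fun j => g (1 + t + j)), show 1 + t + t = 2 * t + 1 by omega]
  simp only [hg]
  simp only [mul_assoc]

/-- The operator `A ⊗ V^{⊗ t} ⊗ A^{⊗ t} ⊗ W`. -/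
def localOp (t : ℕ) (A V W : Matrix (Fin d) (Fin d) ℂ) : CombOp d t :=
  A ⊗ₖ (tensorOp (fun _ : Fin t => V) ⊗ₖ (tensorOp (fun _ : Fin t => A) ⊗ₖ W))

lemma localOp_apply (A V W : Matrix (Fin d) (Fin d) ℂ) (x y : Idx d t) :
    localOp t A V W x y = A x.1 y.1 * ((∏ j, V (x.2.1 j) (y.2.1 j)) *
      ((∏ j, A (x.2.2.1 j) (y.2.2.1 j)) * W x.2.2.2 y.2.2.2)) := by
  simp [localOp, tensorOp, Matrix.kroneckerMap_apply]

/-- The regrouping turns `A^{⊗ (t+1)} ⊗ V^{⊗ t} ⊗ W` into `A ⊗ V^{⊗ t} ⊗ A^{⊗ t} ⊗ W`. -/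
lemma rhoO_submatrix_relabel {σ : Equiv.Perm (Fin (2 * t + 2))} (hσ : IsGrouping σ)
    (O : Matrix (Fin d) (Fin d) ℂ) (g : SymGroup O) :
    (rhoO t O g).submatrix (relabel σ) (relabel σ) =
      localOp t (g.1 : Matrix (Fin d) (Fin d) ℂ) ((g.2.1 : UGroup d) : Matrix (Fin d) (Fin d) ℂ)
        ((g.2.2 : UGroup d) : Matrix (Fin d) (Fin d) ℂ) := by
  ext x y
  rw [localOp_apply]
  simp only [rhoO, tensorOp, Matrix.submatrix_apply, Matrix.of_apply, relabel_apply, permIdx]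
  rw [← Equiv.prod_comp σ, prod_systems]
  simp only [Equiv.symm_apply_apply, flatten_P, flatten_I, flatten_O, flatten_F]
  congr 1
  · rw [if_pos]
    rw [hσ.map_P _ rfl]; omega
  congr 1
  · refine Finset.prod_congr rfl fun j _ => ?_
    have h := hσ.map_I ⟨1 + j, by omega⟩ (by simp) (by simp; omega)
    rw [if_neg (by omega), if_pos (by omega)]
  congr 1
  · refine Finset.prod_congr rfl fun j _ => ?_
    have h := hσ.map_O ⟨1 + t + j, by omega⟩ (by simp; omega) (by simp; omega)
    rw [if_pos (by omega)]
  · have h := hσ.map_F ⟨2 * t + 1, by omega⟩ rfl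
    rw [if_neg (by omega), if_neg (by omega)]

end Index

/-! ### The commutant in a Schur basis -/

namespace SchurBasis

variable {d t : ℕ} {O : Matrix (Fin d) (Fin d) ℂ} (B : SchurBasis t O)

lemma groupedOp_apply (c : B.Blocks) (x y : Fin (2 * t + 2) → Fin d) :
    B.groupedOp c x y = ∑ r, ∑ α, ∑ β, ∑ a, c r α β * (B.vec r a α x * star (B.vec r a β y)) := by
  simp only [groupedOp, Matrix.sum_apply, Matrix.smul_apply, smul_eq_mul, Finset.mul_sum,
    Matrix.vecMulVec_apply, Pi.star_apply]

/-- The matrix `⨁ r, 1_{V_r} ⊗ C^{(r)}`. -/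
def blockOp (c : B.Blocks) : Matrix (Σ r, Fin (B.dim r) × Fin (B.mult r))
    (Σ r, Fin (B.dim r) × Fin (B.mult r)) ℂ :=
  Matrix.blockDiagonal' fun r => (1 : Matrix (Fin (B.dim r)) (Fin (B.dim r)) ℂ) ⊗ₖ c r

lemma blockOp_apply_same (c : B.Blocks) (r : B.I) (a b : Fin (B.dim r)) (α β : Fin (B.mult r)) :
    B.blockOp c ⟨r, (a, α)⟩ ⟨r, (b, β)⟩ = if a = b then c r α β else 0 := by
  simp [blockOp, Matrix.blockDiagonal'_apply_eq, Matrix.one_apply]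

lemma groupedOp_eq (c : B.Blocks) : B.groupedOp c = B.Q * B.blockOp c * B.Q.conjTranspose := by
  ext x y
  rw [groupedOp_apply, Matrix.mul_apply]
  simp only [Matrix.mul_apply, Fintype.sum_sigma, Fintype.sum_prod_type]
  refine Finset.sum_congr rfl fun r _ => ?_
  have h : ∀ (b : Fin (B.dim r)) (β : Fin (B.mult r)),
      (∑ s, ∑ a, ∑ α, B.Q x ⟨s, (a, α)⟩ * B.blockOp c ⟨s, (a, α)⟩ ⟨r, (b, β)⟩) =
        ∑ α, B.Q x ⟨r, (b, α)⟩ * c r α β := by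
    intro b β
    rw [Finset.sum_eq_single r, Finset.sum_eq_single b]
    · simp [blockOp_apply_same]
    · intro a _ hab
      simp [blockOp_apply_same, hab]
    · simp
    · intro s _ hs
      simp [blockOp, Matrix.blockDiagonal'_apply_ne _ _ _ hs]
    · simp
  simp only [h, Finset.sum_mul, Matrix.conjTranspose_apply, vec]
  rw [Finset.sum_comm]
  calc _ = ∑ β, ∑ α, ∑ a, c r α β * (B.Q x ⟨r, (a, α)⟩ * star (B.Q y ⟨r, (a, β)⟩)) := rfl
    _ = ∑ β, ∑ a, ∑ α, c r α β * (B.Q x ⟨r, (a, α)⟩ * star (B.Q y ⟨r, (a, β)⟩)) :=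
        Finset.sum_congr rfl fun β _ => Finset.sum_comm
    _ = _ := by
        rw [Finset.sum_comm]
        exact Finset.sum_congr rfl fun a _ => Finset.sum_congr rfl fun β _ =>
          Finset.sum_congr rfl fun α _ => by ring

lemma blockOp_eq (c : B.Blocks) : B.blockOp c = B.Q.conjTranspose * B.groupedOp c * B.Q := by
  rw [groupedOp_eq]
  calc B.blockOp c = (B.Q.conjTranspose * B.Q) * B.blockOp c * (B.Q.conjTranspose * B.Q) := by
        rw [B.conjTranspose_mul_self, Matrix.one_mul, Matrix.mul_one]
    _ = _ := by simp only [Matrix.mul_assoc]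

lemma dim_pos (r : B.I) : 0 < B.dim r := by
  by_contra h
  have h0 : B.dim r = 0 := by omega
  have : IsEmpty (Fin (B.dim r)) := by rw [h0]; infer_instance
  have hs := B.irreducible r
  obtain ⟨x, y, hxy⟩ := hs.exists_pair_ne
  refine hxy (Subrepresentation.toSubmodule_injective ?_)
  exact Subsingleton.elim _ _

lemma groupedOp_injective : Function.Injective B.groupedOp := by
  intro c c' h
  have h' : B.blockOp c = B.blockOp c' := by rw [blockOp_eq, blockOp_eq, h]
  ext r α β
  have := congrFun (congrFun h' ⟨r, (⟨0, B.dim_pos r⟩, α)⟩) ⟨r, (⟨0, B.dim_pos r⟩, β)⟩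
  simpa [blockOp_apply_same] using this

lemma posSemidef_groupedOp_iff (c : B.Blocks) :
    (B.groupedOp c).PosSemidef ↔ ∀ r, (c r).PosSemidef := by
  constructor
  · intro h r
    have h1 : (B.blockOp c).PosSemidef := by
      rw [blockOp_eq]; exact h.conjTranspose_mul_mul_same B.Q
    have h2 := h1.submatrix fun α : Fin (B.mult r) =>
      (⟨r, (⟨0, B.dim_pos r⟩, α)⟩ : Σ r, Fin (B.dim r) × Fin (B.mult r))
    convert h2 using 1
    ext α β
    simp [blockOp_apply_same]
  · intro h
    have h1 : (B.blockOp c).PosSemidef := by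
      have hsq : ∀ r, ∃ m : Matrix (Fin (B.mult r)) (Fin (B.mult r)) ℂ,
          c r = m.conjTranspose * m := fun r => by
        open scoped MatrixOrder Matrix.Norms.L2Operator in
        exact CStarAlgebra.nonneg_iff_eq_star_mul_self.mp (h r).nonneg
      choose m hm using hsq
      have : B.blockOp c = (B.blockOp m).conjTranspose * B.blockOp m := by
        simp only [blockOp]
        rw [Matrix.blockDiagonal'_conjTranspose, ← Matrix.blockDiagonal'_mul]
        congr 1
        ext1 r
        rw [Matrix.conjTranspose_kronecker, ← Matrix.mul_kronecker_mul, Matrix.conjTranspose_one,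
          Matrix.one_mul, ← hm]
      rw [this]
      exact Matrix.posSemidef_conjTranspose_mul_self _
    rw [groupedOp_eq]
    exact h1.mul_mul_conjTranspose_same B.Q

lemma trace_groupedOp (c : B.Blocks) :
    (B.groupedOp c).trace = ∑ r, (B.dim r : ℂ) * (c r).trace := by
  rw [groupedOp_eq, Matrix.trace_mul_comm, ← Matrix.mul_assoc, B.conjTranspose_mul_self,
    Matrix.one_mul, blockOp, Matrix.trace_blockDiagonal']
  simp [Matrix.trace_kronecker]

lemma rhoO_eq (g : SymGroup O) : rhoO t O g = B.Q * (Matrix.blockDiagonal' fun r =>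
      LinearMap.toMatrix' (B.irrep r g) ⊗ₖ (1 : Matrix (Fin (B.mult r)) (Fin (B.mult r)) ℂ)) *
        B.Q.conjTranspose := by
  rw [← B.block g]
  calc _ = (B.Q * B.Q.conjTranspose) * rhoO t O g * (B.Q * B.Q.conjTranspose) := by
        rw [B.mul_conjTranspose_self, Matrix.one_mul, Matrix.mul_one]
    _ = _ := by simp only [Matrix.mul_assoc]

lemma commute_groupedOp (c : B.Blocks) (g : SymGroup O) :
    Commute (B.groupedOp c) (rhoO t O g) := by
  set R := Matrix.blockDiagonal' fun r =>
      LinearMap.toMatrix' (B.irrep r g) ⊗ₖ (1 : Matrix (Fin (B.mult r)) (Fin (B.mult r)) ℂ) with hR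
  have hc : B.blockOp c * R = R * B.blockOp c := by
    rw [hR, blockOp, ← Matrix.blockDiagonal'_mul, ← Matrix.blockDiagonal'_mul]
    simp only [← Matrix.mul_kronecker_mul, Matrix.one_mul, Matrix.mul_one]
  rw [commute_iff_eq, B.rhoO_eq g, ← hR, groupedOp_eq]
  calc _ = B.Q * B.blockOp c * (B.Q.conjTranspose * B.Q) * R * B.Q.conjTranspose := by
        simp only [Matrix.mul_assoc]
    _ = B.Q * R * (B.Q.conjTranspose * B.Q) * B.blockOp c * B.Q.conjTranspose := by
        rw [B.conjTranspose_mul_self, Matrix.mul_one, Matrix.mul_one, Matrix.mul_assoc B.Q, hc,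
          Matrix.mul_assoc B.Q R]
    _ = _ := by simp only [Matrix.mul_assoc]

/-- **Schur's lemma** in matrix form: the blocks of an operator commuting with the representation
are intertwiners between the irreducible constituents, so the commutant consists of the operators
`⨁ r, 1_{V_r} ⊗ C^{(r)}`. -/
lemma exists_groupedOp_eq (M : Matrix (Fin (2 * t + 2) → Fin d) (Fin (2 * t + 2) → Fin d) ℂ)
    (hM : ∀ g : SymGroup O, Commute M (rhoO t O g)) : ∃ c, B.groupedOp c = M := by
  set N := B.Q.conjTranspose * M * B.Q with hN
  have hMN : M = B.Q * N * B.Q.conjTranspose := by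
    calc M = (B.Q * B.Q.conjTranspose) * M * (B.Q * B.Q.conjTranspose) := by
          rw [B.mul_conjTranspose_self, Matrix.one_mul, Matrix.mul_one]
      _ = _ := by simp only [hN, Matrix.mul_assoc]
  have hcomm : ∀ g, N * (Matrix.blockDiagonal' fun r =>
      LinearMap.toMatrix' (B.irrep r g) ⊗ₖ (1 : Matrix (Fin (B.mult r)) (Fin (B.mult r)) ℂ)) =
      (Matrix.blockDiagonal' fun r => LinearMap.toMatrix' (B.irrep r g) ⊗ₖ
        (1 : Matrix (Fin (B.mult r)) (Fin (B.mult r)) ℂ)) * N := by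
    intro g
    rw [← B.block g, hN]
    calc _ = B.Q.conjTranspose * M * (B.Q * B.Q.conjTranspose) * rhoO t O g * B.Q := by
          simp only [Matrix.mul_assoc]
      _ = B.Q.conjTranspose * rhoO t O g * (B.Q * B.Q.conjTranspose) * M * B.Q := by
          rw [B.mul_conjTranspose_self, Matrix.mul_one, Matrix.mul_one,
            Matrix.mul_assoc _ M, (hM g).eq, ← Matrix.mul_assoc]
      _ = _ := by simp only [Matrix.mul_assoc]
  -- the block of `N` with multiplicity labels `α`, `β`, as a linear map `V_s → V_r`
  let T : ∀ r s : B.I, Fin (B.mult r) → Fin (B.mult s) →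
      Matrix (Fin (B.dim r)) (Fin (B.dim s)) ℂ :=
    fun r s α β => Matrix.of fun a b => N ⟨r, (a, α)⟩ ⟨s, (b, β)⟩
  have hT : ∀ r s α β g, T r s α β * LinearMap.toMatrix' (B.irrep s g) =
      LinearMap.toMatrix' (B.irrep r g) * T r s α β := by
    intro r s α β g
    ext a b
    have h := congrFun (congrFun (hcomm g) ⟨r, (a, α)⟩) ⟨s, (b, β)⟩
    rw [Matrix.mul_apply, Matrix.mul_apply, Fintype.sum_sigma, Fintype.sum_sigma,
      Finset.sum_eq_single s, Finset.sum_eq_single r] at h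
    · simpa [Matrix.blockDiagonal'_apply_eq, Fintype.sum_prod_type, Matrix.one_apply,
        Matrix.mul_apply, T] using h
    · intro q _ hq
      refine Finset.sum_eq_zero fun i _ => ?_
      rw [Matrix.blockDiagonal'_apply_ne _ _ _ hq.symm, zero_mul]
    · simp
    · intro q _ hq
      refine Finset.sum_eq_zero fun i _ => ?_
      rw [Matrix.blockDiagonal'_apply_ne _ _ _ hq, mul_zero]
    · simp
  let τ : ∀ r s : B.I, Fin (B.mult r) → Fin (B.mult s) →
      (B.irrep s).IntertwiningMap (B.irrep r) := fun r s α β =>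
    ⟨Matrix.toLin' (T r s α β), fun g => by
      apply LinearMap.toMatrix'.injective
      rw [LinearMap.toMatrix'_comp, LinearMap.toMatrix'_comp, LinearMap.toMatrix'_toLin', hT]⟩
  have hτ : ∀ r s α β, T r s α β = LinearMap.toMatrix' (τ r s α β).toLinearMap := by
    intro r s α β
    simp [τ]
  have hne : ∀ r s α β, r ≠ s → T r s α β = 0 := by
    intro r s α β hrs
    have := B.irreducible r
    have := B.irreducible s
    have := B.inequivalent s r hrs.symm
    rw [hτ, Subsingleton.elim (τ r s α β) 0]
    simp
  have heq : ∀ r α β, ∃ z : ℂ, T r r α β = z • (1 : Matrix (Fin (B.dim r)) (Fin (B.dim r)) ℂ) := by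
    intro r α β
    have := B.irreducible r
    obtain ⟨z, hz⟩ :=
      (Representation.IsIrreducible.algebraMap_intertwiningMap_bijective_of_isAlgClosed
      (ρ := B.irrep r)).2 (τ r r α β)
    refine ⟨z, ?_⟩
    rw [hτ, ← hz, ← LinearMap.toMatrix'_one, ← map_smul]
    rfl
  choose c hc using heq
  refine ⟨fun r => Matrix.of (c r), ?_⟩
  rw [groupedOp_eq, hMN]
  congr 2
  ext ⟨r, a, α⟩ ⟨s, b, β⟩
  by_cases hrs : r = s
  · subst hrs
    have := congrFun (congrFun (hc r α β) a) b
    simp only [T, Matrix.of_apply, Matrix.smul_apply, Matrix.one_apply, smul_eq_mul, mul_ite,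
      mul_one, mul_zero] at this
    rw [blockOp_apply_same, this]
    rfl
  · rw [blockOp, Matrix.blockDiagonal'_apply_ne _ _ _ hrs]
    exact (congrFun (congrFun (hne r s α β hrs) a) b).symm

variable (σ : Equiv.Perm (Fin (2 * t + 2)))

lemma assemble_eq_submatrix (c : B.Blocks) :
    B.assemble σ c = (B.groupedOp c).submatrix (relabel σ) (relabel σ) := rfl

lemma assemble_injective : Function.Injective (B.assemble σ) := by
  intro c c' h
  refine B.groupedOp_injective ?_
  ext x y
  have := congrFun (congrFun h ((relabel σ).symm x)) ((relabel σ).symm y)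
  simpa only [assemble_eq_submatrix, Matrix.submatrix_apply, Equiv.apply_symm_apply] using this

lemma posSemidef_assemble_iff (c : B.Blocks) :
    (B.assemble σ c).PosSemidef ↔ ∀ r, (c r).PosSemidef := by
  rw [assemble_eq_submatrix, Matrix.posSemidef_submatrix_equiv, posSemidef_groupedOp_iff]

lemma trace_assemble (c : B.Blocks) :
    (B.assemble σ c).trace = ∑ r, (B.dim r : ℂ) * (c r).trace := by
  rw [← trace_groupedOp, assemble_eq_submatrix, Matrix.trace, Matrix.trace]
  exact Equiv.sum_comp (relabel σ) fun x => B.groupedOp c x x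

variable {σ}

lemma symmetric_assemble (hσ : IsGrouping σ) (c : B.Blocks) : Symmetric O (B.assemble σ c) := by
  intro U V W
  have h := rhoO_submatrix_relabel hσ O (U, V, W)
  rw [localOp] at h
  rw [← h, commute_iff_eq, assemble_eq_submatrix, Matrix.submatrix_mul_equiv,
    Matrix.submatrix_mul_equiv, (B.commute_groupedOp c _).eq]

lemma exists_assemble_eq (hσ : IsGrouping σ) {C : CombOp d t} (hC : Symmetric O C) :
    ∃ c, B.assemble σ c = C := by
  obtain ⟨c, hc⟩ := B.exists_groupedOp_eq (C.submatrix (relabel σ).symm (relabel σ).symm) <| by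
    rintro ⟨U, V, W⟩
    have h := rhoO_submatrix_relabel hσ O (U, V, W)
    have h' : rhoO t O (U, V, W) = (localOp t U (V : UGroup d) (W : UGroup d)).submatrix
        (relabel σ).symm (relabel σ).symm := by
      rw [← h]; simp
    rw [h', commute_iff_eq, Matrix.submatrix_mul_equiv, Matrix.submatrix_mul_equiv,
      show C * localOp t _ _ _ = _ from (hC U V W).eq]
    rfl
  refine ⟨c, ?_⟩
  rw [assemble_eq_submatrix, hc]
  simp

end SchurBasis

/-! ### The linear constraints -/

section Constraints

variable {d t : ℕ}

lemma trOF_apply_eq_sum (C : CombOp d t) (u v : Fin d × (Fin t → Fin d)) :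
    trOF C u v = ∑ k, trF C (u, k) (v, k) := rfl

lemma trace_eq_sum_trIOF (C : CombOp d t) : C.trace = ∑ p, trIOF C p p := by
  simp only [Matrix.trace, Matrix.diag_apply, trIOF, Matrix.of_apply, Fintype.sum_prod_type]

/-- If finitely many numbers `L k` are equal to the average of all of them for `k` in a set `s`, and
vanish for the other `k`, then either `s` is everything or the sum is zero; hence each of
them is equal to the average. -/
lemma eq_average_of_eq_average_on {ι : Type*} [Fintype ι] (s : Set ι) (L : ι → ℂ) {N : ℂ}
    (hN : N = Fintype.card ι)
    (h0 : ∀ k, k ∉ s → L k = 0)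
    (h1 : ∀ k, k ∈ s → L k = 1 / N * ∑ j, L j) (k : ι) :
    L k = 1 / N * ∑ j, L j := by
  classical
  by_cases hk : k ∈ s
  · exact h1 k hk
  rw [h0 k hk]
  have hsum : ∑ j, L j = ∑ j with j ∈ s, L j := by
    rw [Finset.sum_filter]
    refine Finset.sum_congr rfl fun j _ => ?_
    split_ifs with hj
    · rfl
    · exact h0 j hj
  have hN0 : N ≠ 0 := by
    have : Nonempty ι := ⟨k⟩
    rw [hN]
    exact_mod_cast Fintype.card_ne_zero
  have hlt : (Finset.univ.filter (· ∈ s)).card < Fintype.card ι :=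
    Finset.card_lt_univ_of_notMem (x := k) (by simpa using hk)
  have hS : ∑ j, L j =
      ((Finset.univ.filter (· ∈ s)).card : ℂ) * (1 / N * ∑ j, L j) := by
    conv_lhs => rw [hsum, Finset.sum_congr rfl fun j hj => h1 j (by simpa using hj)]
    rw [Finset.sum_const, nsmul_eq_mul]
  have hne : N - ((Finset.univ.filter (· ∈ s)).card : ℂ) ≠ 0 := by
    rw [hN, sub_ne_zero]
    exact_mod_cast hlt.ne'
  have : (N - ((Finset.univ.filter (· ∈ s)).card : ℂ)) * ∑ j, L j = 0 := by
    field_simp at hS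
    linear_combination hS
  rw [(mul_eq_zero.1 this).resolve_left hne, mul_zero]

end Constraints

namespace SchurBasis

variable {d t : ℕ} {O : Matrix (Fin d) (Fin d) ℂ} (B : SchurBasis t O)
  (σ : Equiv.Perm (Fin (2 * t + 2)))

lemma assemble_apply (c : B.Blocks) (x y : Idx d t) :
    B.assemble σ c x y =
      ∑ r, ∑ α, ∑ β, ∑ a, c r α β * (B.coeff σ r a α x * star (B.coeff σ r a β y)) :=
  B.groupedOp_apply c _ _

section Split

variable {R X Y : Type} [Fintype Y] (join : R → X → Y → Idx d t)

lemma tildeM_apply (r : B.I) (u v : R × X) (β α : Fin (B.mult r)) :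
    B.tildeM join σ r u v β α = ∑ a, ∑ y,
      B.coeff σ r a α (join u.1 u.2 y) * star (B.coeff σ r a β (join v.1 v.2 y)) := by
  classical
  rw [← Fintype.sum_prod_type', tildeM, Matrix.of_apply, Finset.sum_filter]
  refine Finset.sum_congr rfl fun ay _ => ?_
  split_ifs with h
  · rfl
  · rw [Set.mem_inter_iff, not_and_or] at h
    rcases h with h | h <;> simp only [supp, Set.mem_ofPred_eq, not_exists, not_not] at h
    · rw [h α, zero_mul]
    · rw [h β, star_zero, mul_zero]

/-- The left-hand sides of the reduced constraints are the entries of partial traces of the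
assembled operator. -/
lemma sum_trace_mul_tildeM (c : B.Blocks) (u v : R × X) :
    ∑ r, (c r * B.tildeM join σ r u v).trace =
      ∑ y, B.assemble σ c (join u.1 u.2 y) (join v.1 v.2 y) := by
  simp only [assemble_apply]
  refine Eq.trans (Finset.sum_congr rfl fun r _ => ?_) Finset.sum_comm
  simp only [Matrix.trace, Matrix.diag_apply, Matrix.mul_apply, tildeM_apply, Finset.mul_sum]
  refine Eq.trans (Finset.sum_congr rfl fun α _ => ?_) Finset.sum_comm
  refine Eq.trans (Finset.sum_congr rfl fun β _ => ?_) Finset.sum_comm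
  exact Finset.sum_comm

lemma tildeM_eq_zero {u v : R × X} (h : (u, v) ∉ B.tildeS join σ) (r : B.I) :
    B.tildeM join σ r u v = 0 := by
  classical
  have he : B.supp join σ r u ∩ B.supp join σ r v = ∅ := by
    by_contra hne
    have hne := Set.nonempty_iff_ne_empty.2 hne
    exact h (Set.mem_iUnion.2 ⟨r, ⟨hne.mono Set.inter_subset_left,
      hne.mono Set.inter_subset_right⟩, hne⟩)
  ext β α
  simp [tildeM, he]

end Split

lemma trF_assemble (c : B.Blocks) (u v : (Fin d × (Fin t → Fin d)) × (Fin t → Fin d)) :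
    trF (B.assemble σ c) u v = ∑ r, (c r * B.tildeM joinO σ r u v).trace :=
  (B.sum_trace_mul_tildeM σ joinO c u v).symm

lemma trIOF_assemble (c : B.Blocks) (p q : Fin d) :
    trIOF (B.assemble σ c) p q = ∑ r, (c r * B.tildeM joinP σ r (p, ()) (q, ())).trace := by
  rw [sum_trace_mul_tildeM]
  simp only [trIOF, Matrix.of_apply, Fintype.sum_prod_type, joinP]

/-- A constraint demanded only on the pairs of labels whose supports meet holds for all pairs. -/
lemma constraint_of_tildeS {R X Y : Type} [Fintype X] [DecidableEq X] [Fintype Y]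
    (join : R → X → Y → Idx d t) (c : B.Blocks) {N : ℂ} (hN : N = Fintype.card X)
    (h : ∀ u v, (u, v) ∈ B.tildeS join σ → ∑ r, (c r * B.tildeM join σ r u v).trace =
      (if u.2 = v.2 then 1 else 0) / N *
        ∑ k, ∑ r, (c r * B.tildeM join σ r (u.1, k) (v.1, k)).trace) (u v : R × X) :
    ∑ r, (c r * B.tildeM join σ r u v).trace =
      (if u.2 = v.2 then 1 else 0) / N *
        ∑ k, ∑ r, (c r * B.tildeM join σ r (u.1, k) (v.1, k)).trace := by
  have h0 : ∀ u v : R × X, (u, v) ∉ B.tildeS join σ →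
      ∑ r, (c r * B.tildeM join σ r u v).trace = 0 := fun u v huv =>
    Finset.sum_eq_zero fun r _ => by rw [B.tildeM_eq_zero σ join huv]; simp
  obtain ⟨u, k⟩ := u
  obtain ⟨v, l⟩ := v
  by_cases hkl : k = l
  · subst hkl
    rw [if_pos rfl]
    refine eq_average_of_eq_average_on {k | ((u, k), (v, k)) ∈ B.tildeS join σ}
      (fun k => ∑ r, (c r * B.tildeM join σ r (u, k) (v, k)).trace) hN (fun k hk => h0 _ _ hk)
      (fun k hk => ?_) k
    have := h _ _ hk
    rwa [if_pos rfl] at this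
  · by_cases hm : ((u, k), (v, l)) ∈ B.tildeS join σ
    · exact h _ _ hm
    · rw [h0 _ _ hm, if_neg hkl]; simp

lemma feasible_assemble_iff (c : B.Blocks) :
    Feasible (B.assemble σ c) ↔ B.ReducedFeasible σ c := by
  have hF : trF (B.assemble σ c) = trOF (B.assemble σ c) ⊗ₖ (((d : ℂ) ^ t)⁻¹ •
      (1 : Matrix (Fin t → Fin d) (Fin t → Fin d) ℂ)) ↔
      ∀ u v : (Fin d × (Fin t → Fin d)) × (Fin t → Fin d),
        ∑ r, (c r * B.tildeM joinO σ r u v).trace = (if u.2 = v.2 then 1 else 0) / (d : ℂ) ^ t *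
          ∑ k, ∑ r, (c r * B.tildeM joinO σ r (u.1, k) (v.1, k)).trace := by
    rw [← Matrix.ext_iff]
    refine forall_congr' fun u => forall_congr' fun v => ?_
    rw [trF_assemble, Matrix.kroneckerMap_apply, trOF_apply_eq_sum, Matrix.smul_apply,
      Matrix.one_apply, mul_comm (∑ k, _) (_ • _)]
    simp only [trF_assemble, smul_eq_mul, div_eq_inv_mul]
  have hP : trIOF (B.assemble σ c) = (B.assemble σ c).trace • ((d : ℂ)⁻¹ •
      (1 : Matrix (Fin d) (Fin d) ℂ)) ↔
      ∀ i j : Fin d, ∑ r, (c r * B.tildeM joinP σ r (i, ()) (j, ())).trace =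
        (if i = j then 1 else 0) / (d : ℂ) *
          ∑ k, ∑ r, (c r * B.tildeM joinP σ r (k, ()) (k, ())).trace := by
    rw [← Matrix.ext_iff]
    refine forall_congr' fun i => forall_congr' fun j => ?_
    rw [trIOF_assemble, trace_eq_sum_trIOF, Matrix.smul_apply, Matrix.smul_apply, Matrix.one_apply,
      smul_eq_mul, mul_comm (∑ k, _)]
    simp only [trIOF_assemble, smul_eq_mul, div_eq_inv_mul]
  constructor
  · intro h
    refine ⟨fun u v _ => hF.1 h.trF_eq u v, fun i j _ => hP.1 h.trIOF_eq i j, ?_,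
      (B.posSemidef_assemble_iff σ c).1 h.posSemidef⟩
    rw [← trace_assemble B σ, h.trace_eq, pow_succ']
  · intro h
    refine ⟨(B.posSemidef_assemble_iff σ c).2 h.posSemidef, hF.2 ?_, hP.2 ?_, ?_⟩
    · exact B.constraint_of_tildeS σ joinO c (by simp) h.constraint_O
    -- here the averaged label is that of `P` itself, the middle part of the splitting being empty
    · intro i j
      have h0 : ∀ i j, ((i, ()), (j, ())) ∉ B.tildeS joinP σ →
          ∑ r, (c r * B.tildeM joinP σ r (i, ()) (j, ())).trace = 0 := fun i j hij =>
        Finset.sum_eq_zero fun r _ => by rw [B.tildeM_eq_zero σ joinP hij]; simp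
      by_cases hij : i = j
      · subst hij
        rw [if_pos rfl]
        exact eq_average_of_eq_average_on {k | ((k, ()), (k, ())) ∈ B.tildeS joinP σ}
          (fun k => ∑ r, (c r * B.tildeM joinP σ r (k, ()) (k, ())).trace)
          (by simp) (fun k hk => h0 _ _ hk) (fun k hk => by
            have := h.constraint_P _ _ hk
            rwa [if_pos rfl] at this) i
      · by_cases hm : ((i, ()), (j, ())) ∈ B.tildeS joinP σ
        · exact h.constraint_P _ _ hm
        · rw [h0 _ _ hm, if_neg hij]; simp
    · rw [trace_assemble B σ, h.trace_eq, pow_succ']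

end SchurBasis

/-! ### The objective functions -/

section Objective

variable {d t : ℕ}

lemma sum_comm_three {α β γ : Type*} [Fintype α] [Fintype β] [Fintype γ] (F : α → β → γ → ℂ) :
    ∑ c, ∑ a, ∑ b, F a b c = ∑ a, ∑ b, ∑ c, F a b c := by
  rw [Finset.sum_comm]
  exact Finset.sum_congr rfl fun _ _ => Finset.sum_comm

lemma sum_comm_four {α β γ δ : Type*} [Fintype α] [Fintype β] [Fintype γ] [Fintype δ]
    (F : α → β → γ → δ → ℂ) :
    ∑ c, ∑ e, ∑ a, ∑ b, F a b c e = ∑ a, ∑ b, ∑ c, ∑ e, F a b c e := by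
  exact (Finset.sum_congr rfl fun _ _ => sum_comm_three _).trans
    (sum_comm_three fun a b c => ∑ e, F a b c e)

/-- The operator `1_P ⊗ ⟨⟨U*|^{⊗ t} ⊗ 1_F` from `H_P ⊗ H_I ⊗ H_O ⊗ H_F` to `H_P ⊗ H_F`. Contracting
with it on both sides is the link product with `|U⟩⟩⟨⟨U|^{⊗ t}`. -/
def slotContraction (t : ℕ) (U : Matrix (Fin d) (Fin d) ℂ) : Matrix (Fin d × Fin d) (Idx d t) ℂ :=
  Matrix.of fun u x => (1 : Matrix (Fin d) (Fin d) ℂ) u.1 x.1 *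
    (∏ l, U (x.2.2.1 l) (x.2.1 l)) * (1 : Matrix (Fin d) (Fin d) ℂ) u.2 x.2.2.2

lemma slotContraction_mul_mul_apply (U : Matrix (Fin d) (Fin d) ℂ) (C : CombOp d t)
    (p f q f' : Fin d) :
    (slotContraction t U * C * (slotContraction t U).conjTranspose) (p, f) (q, f') =
      ∑ i, ∑ o, ∑ i', ∑ o', C (p, i, o, f) (q, i', o', f') *
        ∏ l, U (o l) (i l) * star (U (o' l) (i' l)) := by
  simp only [Matrix.mul_apply, slotContraction, Matrix.of_apply, Matrix.one_apply, ite_mul,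
    one_mul, zero_mul, mul_ite, mul_one, mul_zero, Fintype.sum_prod_type, Finset.sum_ite_eq,
    Finset.sum_ite_irrel, Finset.sum_const_zero, Finset.mem_univ, if_true,
    Matrix.conjTranspose_apply, apply_ite star, star_zero, Finset.sum_mul,
    Finset.prod_mul_distrib]
  rw [sum_comm_four]
  refine Finset.sum_congr rfl fun i _ => Finset.sum_congr rfl fun o _ =>
    Finset.sum_congr rfl fun i' _ => Finset.sum_congr rfl fun o' _ => ?_
  rw [star_prod]
  ring

lemma linkProduct_choiPow (U : Matrix (Fin d) (Fin d) ℂ) (C : CombOp d t) :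
    linkProduct C (choiPow t U) =
      slotContraction t U * C * (slotContraction t U).conjTranspose := by
  ext ⟨p, f⟩ ⟨q, f'⟩
  rw [slotContraction_mul_mul_apply]
  simp only [linkProduct, trIO, Matrix.of_apply, Matrix.mul_apply, transposeIO, extendIO,
    Matrix.one_apply, ite_mul, one_mul, zero_mul, mul_ite, mul_one, mul_zero,
    Fintype.sum_prod_type, Finset.sum_ite_eq', Finset.sum_ite_irrel,
    Finset.sum_const_zero, Finset.mem_univ, if_true, choiPow, choiOp, choiVec,
    Matrix.vecMulVec_apply, Pi.star_apply]
  exact sum_comm_four _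

/-- `Tr_F [ D (1_P ⊗ O_F) ]ᵀ` for an operator `D` on `H_P ⊗ H_F`. -/
def contractF (O : Matrix (Fin d) (Fin d) ℂ) (D : Matrix (Fin d × Fin d) (Fin d × Fin d) ℂ) :
    Matrix (Fin d) (Fin d) ℂ :=
  Matrix.of fun q p => ∑ f, ∑ f', D (p, f) (q, f') * O f' f

/-- The operator that the comb `C` with `U` inserted into its slots assigns to the observable
`O`, to be compared with `U O U†`. -/
def combOutput (O : Matrix (Fin d) (Fin d) ℂ) (C : CombOp d t) (U : Matrix (Fin d) (Fin d) ℂ) :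
    Matrix (Fin d) (Fin d) ℂ :=
  contractF O (slotContraction t U * C * (slotContraction t U).conjTranspose)

lemma trFst_switchConj (O : Matrix (Fin d) (Fin d) ℂ)
    (D : Matrix (Fin d × Fin d) (Fin d × Fin d) ℂ) :
    trFst (switchConj D.transpose * (O.transpose ⊗ₖ (1 : Matrix (Fin d) (Fin d) ℂ))) =
      contractF O D := by
  ext q p
  simp only [trFst, contractF, Matrix.of_apply, Matrix.mul_apply, switchConj,
    Matrix.submatrix_apply, Matrix.transpose_apply, Matrix.kroneckerMap_apply, Matrix.one_apply,
    Fintype.sum_prod_type, Prod.swap_prod_mk, mul_ite, mul_one, mul_zero, Finset.sum_ite_eq',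
    Finset.mem_univ, if_true]
  exact Finset.sum_comm

lemma trFst_choiOp (O U : Matrix (Fin d) (Fin d) ℂ) :
    trFst (choiOp U * (O.transpose ⊗ₖ (1 : Matrix (Fin d) (Fin d) ℂ))) = U * O * star U := by
  ext q p
  simp only [trFst, choiOp, choiVec, Matrix.of_apply, Matrix.mul_apply, Matrix.vecMulVec_apply,
    Matrix.transpose_apply, Matrix.kroneckerMap_apply, Matrix.one_apply, Pi.star_apply,
    Fintype.sum_prod_type, mul_ite, mul_one, mul_zero, Finset.sum_ite_eq', Finset.mem_univ,
    if_true, Matrix.star_apply, Finset.sum_mul]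
  rw [Finset.sum_comm]
  exact Finset.sum_congr rfl fun _ _ => Finset.sum_congr rfl fun _ _ => by ring

lemma trFst_sub (X Y : Matrix (Fin d × Fin d) (Fin d × Fin d) ℂ) :
    trFst (X - Y) = trFst X - trFst Y := by
  ext q p
  simp [trFst]

lemma objective_eq (O : Matrix (Fin d) (Fin d) ℂ) (C : CombOp d t) :
    objective O C = ∫ U : UGroup d, frobNorm (combOutput O C U -
      (U : Matrix (Fin d) (Fin d) ℂ) * O * star (U : Matrix (Fin d) (Fin d) ℂ)) ∂(haarU d) := by
  simp only [objective, trFst_sub, trFst_switchConj, trFst_choiOp, linkProduct_choiPow, combOutput]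

lemma combOutput_apply (O : Matrix (Fin d) (Fin d) ℂ) (C : CombOp d t)
    (U : Matrix (Fin d) (Fin d) ℂ) (q p : Fin d) :
    combOutput O C U q p = ∑ x : (Fin t → Fin d) × (Fin t → Fin d) × Fin d,
      ∑ y : (Fin t → Fin d) × (Fin t → Fin d) × Fin d, C (p, x) (q, y) *
        (∏ l, U (x.2.1 l) (x.1 l) * star (U (y.2.1 l) (y.1 l))) * O y.2.2 x.2.2 := by
  simp only [combOutput, contractF, Matrix.of_apply, slotContraction_mul_mul_apply,
    Fintype.sum_prod_type, Finset.sum_mul]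
  rw [Finset.sum_congr rfl fun f _ => sum_comm_three _, sum_comm_three]
  exact Finset.sum_congr rfl fun i _ => Finset.sum_congr rfl fun o _ =>
    Finset.sum_congr rfl fun f _ => sum_comm_three _

end Objective

namespace SchurBasis

variable {d t : ℕ} {O : Matrix (Fin d) (Fin d) ℂ} (B : SchurBasis t O)
  (σ : Equiv.Perm (Fin (2 * t + 2)))

lemma tildeMU_apply (U : Matrix (Fin d) (Fin d) ℂ) (r : B.I) (q p : Fin d)
    (β α : Fin (B.mult r)) :
    B.tildeMU σ U r q p β α = ∑ a, ∑ x : (Fin t → Fin d) × (Fin t → Fin d) × Fin d,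
      ∑ y : (Fin t → Fin d) × (Fin t → Fin d) × Fin d,
        B.coeff σ r a α (p, x) * star (B.coeff σ r a β (q, y)) *
          (∏ l, U (x.2.1 l) (x.1 l) * star (U (y.2.1 l) (y.1 l))) * O y.2.2 x.2.2 := by
  classical
  rw [tildeMU, Matrix.of_apply]
  refine Finset.sum_congr rfl fun a _ => ?_
  rw [Finset.sum_filter]
  refine Finset.sum_congr rfl fun x _ => ?_
  by_cases hx : B.coeff σ r a α (p, x) = 0
  · simp [nonzeroIdx, hx]
  rw [if_pos (show x ∈ B.nonzeroIdx σ r a α p from hx), Finset.sum_filter]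
  refine Finset.sum_congr rfl fun y _ => ?_
  by_cases hy : B.coeff σ r a β (q, y) = 0
  · simp [nonzeroIdx, hy]
  rw [if_pos (show y ∈ B.nonzeroIdx σ r a β q from hy), Matrix.trace_single_mul]
  simp

lemma sum_trace_mul_tildeMU (c : B.Blocks) (U : Matrix (Fin d) (Fin d) ℂ) (q p : Fin d) :
    ∑ r, (c r * B.tildeMU σ U r q p).trace = combOutput O (B.assemble σ c) U q p := by
  rw [combOutput_apply]
  simp only [assemble_apply, Finset.sum_mul]
  simp only [Matrix.trace, Matrix.diag_apply, Matrix.mul_apply, tildeMU_apply, Finset.mul_sum]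
  refine Eq.trans (Finset.sum_congr rfl fun r _ => ?_) (sum_comm_three _)
  refine Eq.trans (Finset.sum_congr rfl fun α _ => ?_) (sum_comm_three _)
  refine Eq.trans (Finset.sum_congr rfl fun β _ => ?_) (sum_comm_three _)
  refine Eq.trans (Finset.sum_congr rfl fun a _ => ?_) (sum_comm_three _)
  exact Finset.sum_congr rfl fun x _ => Finset.sum_congr rfl fun y _ => by ring

lemma objective_assemble (c : B.Blocks) :
    objective O (B.assemble σ c) = B.reducedObjective σ c := by
  rw [objective_eq, reducedObjective]
  congr 1
  ext U
  congr 2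
  ext q p
  rw [← sum_trace_mul_tildeMU, Matrix.sum_apply]
  refine Finset.sum_congr rfl fun r _ => ?_
  simp [Matrix.sum_apply, Matrix.single_apply, ite_and]

end SchurBasis

/-! ### Local unitaries -/

section LocalUnitaries

variable {d t : ℕ}

lemma sum_sum_prod {n : ℕ} (F : Fin n → Fin d → Fin d → ℂ) :
    ∑ i : Fin n → Fin d, ∑ o : Fin n → Fin d, ∏ l, F l (i l) (o l) =
      ∏ l, ∑ a, ∑ b, F l a b := by
  rw [Finset.prod_univ_sum, Fintype.piFinset_univ]
  refine Finset.sum_congr rfl fun i _ => ?_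
  rw [Finset.prod_univ_sum, Fintype.piFinset_univ]

lemma tensorOp_mul {n : ℕ} (A B : Fin n → Matrix (Fin d) (Fin d) ℂ) :
    tensorOp A * tensorOp B = tensorOp fun k => A k * B k := by
  ext x y
  simp only [tensorOp, Matrix.mul_apply, Matrix.of_apply, ← Finset.prod_mul_distrib]
  rw [Finset.prod_univ_sum, Fintype.piFinset_univ]

lemma tensorOp_one {n : ℕ} : tensorOp (fun _ : Fin n => (1 : Matrix (Fin d) (Fin d) ℂ)) = 1 := by
  ext x y
  simp only [tensorOp, Matrix.of_apply, Matrix.one_apply, Finset.prod_ite_zero,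
    Finset.prod_const_one, Finset.mem_univ, true_imp_iff, funext_iff]

lemma conjTranspose_tensorOp {n : ℕ} (A : Fin n → Matrix (Fin d) (Fin d) ℂ) :
    (tensorOp A).conjTranspose = tensorOp fun k => (A k).conjTranspose := by
  ext x y
  simp only [tensorOp, Matrix.conjTranspose_apply, Matrix.of_apply, star_prod]

lemma localOp_mul (A V W A' V' W' : Matrix (Fin d) (Fin d) ℂ) :
    localOp t A V W * localOp t A' V' W' = localOp t (A * A') (V * V') (W * W') := by
  simp only [localOp, ← Matrix.mul_kronecker_mul, tensorOp_mul]

lemma conjTranspose_localOp (A V W : Matrix (Fin d) (Fin d) ℂ) :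
    (localOp t A V W).conjTranspose =
      localOp t A.conjTranspose V.conjTranspose W.conjTranspose := by
  simp only [localOp, Matrix.conjTranspose_kronecker, conjTranspose_tensorOp]

lemma localOp_one : localOp t (1 : Matrix (Fin d) (Fin d) ℂ) 1 1 = 1 := by
  simp only [localOp, tensorOp_one, Matrix.one_kronecker_one]

lemma conjTranspose_mul_self_coe (U : UGroup d) :
    (U : Matrix (Fin d) (Fin d) ℂ).conjTranspose * U = 1 :=
  Matrix.mem_unitaryGroup_iff'.1 U.2

lemma mul_conjTranspose_self_coe (U : UGroup d) :
    (U : Matrix (Fin d) (Fin d) ℂ) * (U : Matrix (Fin d) (Fin d) ℂ).conjTranspose = 1 :=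
  Matrix.mem_unitaryGroup_iff.1 U.2

lemma conjTranspose_localOp_mul_self (A V W : UGroup d) :
    (localOp t (A : Matrix (Fin d) (Fin d) ℂ) V W).conjTranspose * localOp t A V W = 1 := by
  simp only [conjTranspose_localOp, localOp_mul, conjTranspose_mul_self_coe, localOp_one]

lemma localOp_mul_conjTranspose_self (A V W : UGroup d) :
    localOp t (A : Matrix (Fin d) (Fin d) ℂ) V W * (localOp t A V W).conjTranspose = 1 := by
  simp only [conjTranspose_localOp, localOp_mul, mul_conjTranspose_self_coe, localOp_one]

/-- The symmetry condition says that `C` is fixed by conjugation with the local unitaries. -/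
lemma symmetric_iff (O : Matrix (Fin d) (Fin d) ℂ) (C : CombOp d t) :
    Symmetric O C ↔ ∀ (U : UGroup d) (V W : centralizerU O),
      localOp t (U : Matrix (Fin d) (Fin d) ℂ) (V : UGroup d) (W : UGroup d) * C *
        (localOp t (U : Matrix (Fin d) (Fin d) ℂ) (V : UGroup d) (W : UGroup d)).conjTranspose
          = C := by
  refine forall_congr' fun U => forall_congr' fun V => forall_congr' fun W => ?_
  change C * localOp t (U : Matrix (Fin d) (Fin d) ℂ) (V : UGroup d) (W : UGroup d) =
    localOp t (U : Matrix (Fin d) (Fin d) ℂ) (V : UGroup d) (W : UGroup d) * C ↔ _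
  have h1 := conjTranspose_localOp_mul_self (t := t) U (V : UGroup d) (W : UGroup d)
  have h2 := localOp_mul_conjTranspose_self (t := t) U (V : UGroup d) (W : UGroup d)
  constructor
  · intro h
    rw [← h, Matrix.mul_assoc, h2, Matrix.mul_one]
  · intro h
    conv_lhs => rw [← h]
    rw [Matrix.mul_assoc, h1, Matrix.mul_one]

end LocalUnitaries

/-! ### Invariance of the objective -/

section Invariance

variable {d t : ℕ}

/-- Local unitaries on the slots are absorbed by the inserted operator. -/
lemma slotContraction_mul_localOp (U A V W : Matrix (Fin d) (Fin d) ℂ) :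
    slotContraction t U * localOp t A V W =
      (A ⊗ₖ W) * slotContraction t (A.transpose * U * V) := by
  ext ⟨p, f⟩ ⟨p', i, o, f'⟩
  have h : ∏ l, (A.transpose * U * V) (o l) (i l) = ∑ i' : Fin t → Fin d, ∑ o' : Fin t → Fin d, ∏ l,
      U (o' l) (i' l) * V (i' l) (i l) * A (o' l) (o l) := by
    rw [sum_sum_prod fun l a b => U b a * V a (i l) * A b (o l)]
    refine Finset.prod_congr rfl fun l _ => ?_
    simp only [Matrix.mul_apply, Matrix.transpose_apply, Finset.sum_mul]
    exact Finset.sum_congr rfl fun a _ => Finset.sum_congr rfl fun b _ => by ring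
  simp only [Matrix.mul_apply, slotContraction, localOp_apply, Matrix.of_apply, Matrix.one_apply,
    Matrix.kroneckerMap_apply, Fintype.sum_prod_type, ite_mul, mul_ite, one_mul, mul_one, zero_mul,
    mul_zero, Finset.sum_ite_eq, Finset.sum_ite_eq', Finset.sum_ite_irrel, Finset.sum_const_zero,
    Finset.mem_univ, if_true]
  simp only [← Matrix.mul_apply, h, Finset.mul_sum]
  refine Finset.sum_congr rfl fun i' _ => Finset.sum_congr rfl fun o' _ => ?_
  simp only [Finset.prod_mul_distrib]
  ring

/-- The block `⟨p|_P D |q⟩_P` of an operator on `H_P ⊗ H_F`. -/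
def sliceF (D : Matrix (Fin d × Fin d) (Fin d × Fin d) ℂ) (p q : Fin d) :
    Matrix (Fin d) (Fin d) ℂ :=
  Matrix.of fun f f' => D (p, f) (q, f')

lemma contractF_apply (O : Matrix (Fin d) (Fin d) ℂ)
    (D : Matrix (Fin d × Fin d) (Fin d × Fin d) ℂ) (p q : Fin d) :
    contractF O D q p = (sliceF D p q * O).trace := by
  simp [contractF, sliceF, Matrix.trace, Matrix.mul_apply]

lemma sliceF_conj (A W : Matrix (Fin d) (Fin d) ℂ)
    (D : Matrix (Fin d × Fin d) (Fin d × Fin d) ℂ) (p q : Fin d) :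
    sliceF ((A ⊗ₖ W) * D * (A ⊗ₖ W).conjTranspose) p q =
      ∑ p', ∑ q', (A p p' * star (A q q')) • (W * sliceF D p' q' * W.conjTranspose) := by
  ext f f'
  simp only [sliceF, Matrix.of_apply, Matrix.mul_apply, Matrix.sum_apply, Matrix.smul_apply,
    Matrix.conjTranspose_apply, Matrix.kroneckerMap_apply, Fintype.sum_prod_type, Finset.sum_mul,
    Finset.mul_sum, smul_eq_mul, star_mul']
  rw [← sum_comm_three]
  refine Finset.sum_congr rfl fun p' _ => Finset.sum_congr rfl fun q' _ =>
    Finset.sum_congr rfl fun e' _ => Finset.sum_congr rfl fun e _ => ?_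
  ring

lemma contractF_conj (O A W : Matrix (Fin d) (Fin d) ℂ)
    (D : Matrix (Fin d × Fin d) (Fin d × Fin d) ℂ) :
    contractF O ((A ⊗ₖ W) * D * (A ⊗ₖ W).conjTranspose) =
      A.transpose.conjTranspose * contractF (W.conjTranspose * O * W) D * A.transpose := by
  ext q p
  rw [contractF_apply, sliceF_conj]
  simp only [Matrix.mul_apply, contractF_apply, Finset.sum_mul, Matrix.trace_sum, Matrix.smul_mul,
    Matrix.trace_smul, smul_eq_mul, Matrix.conjTranspose_apply, Matrix.transpose_apply]
  refine Finset.sum_congr rfl fun p' _ => Finset.sum_congr rfl fun q' _ => ?_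
  have : (W * sliceF D p' q' * W.conjTranspose * O).trace =
      (sliceF D p' q' * (W.conjTranspose * O * W)).trace := by
    rw [Matrix.mul_assoc, Matrix.mul_assoc, Matrix.trace_mul_comm]
    simp only [Matrix.mul_assoc]
  rw [this]
  ring

lemma combOutput_conj_localOp {O A V W : Matrix (Fin d) (Fin d) ℂ}
    (hW : W.conjTranspose * O * W = O) (C : CombOp d t) (U : Matrix (Fin d) (Fin d) ℂ) :
    combOutput O (localOp t A V W * C * (localOp t A V W).conjTranspose) U =
      A.transpose.conjTranspose * combOutput O C (A.transpose * U * V) * A.transpose := by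
  have h : slotContraction t U * (localOp t A V W * C * (localOp t A V W).conjTranspose) *
      (slotContraction t U).conjTranspose = (A ⊗ₖ W) * (slotContraction t (A.transpose * U * V) *
        C * (slotContraction t (A.transpose * U * V)).conjTranspose) * (A ⊗ₖ W).conjTranspose := by
    calc _ = (slotContraction t U * localOp t A V W) * C *
        (slotContraction t U * localOp t A V W).conjTranspose := by
          simp only [Matrix.mul_assoc, Matrix.conjTranspose_mul]
      _ = _ := by
          rw [slotContraction_mul_localOp]
          simp only [Matrix.mul_assoc, Matrix.conjTranspose_mul]
  rw [combOutput, h, contractF_conj, hW, combOutput]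

/-- The squared Hilbert–Schmidt norm. -/
noncomputable def hsNormSq {n : Type*} [Fintype n] (A : Matrix n n ℂ) : ℝ := ∑ i, ∑ j, ‖A i j‖ ^ 2

lemma hsNormSq_eq_trace {n : Type*} [Fintype n] (A : Matrix n n ℂ) :
    (hsNormSq A : ℂ) = (A.conjTranspose * A).trace := by
  simp only [hsNormSq, Matrix.trace, Matrix.diag_apply, Matrix.mul_apply,
    Matrix.conjTranspose_apply, Complex.ofReal_sum]
  rw [Finset.sum_comm]
  refine Finset.sum_congr rfl fun j _ => Finset.sum_congr rfl fun i _ => ?_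
  rw [RCLike.star_def, Complex.conj_mul']
  push_cast
  rfl

lemma hsNormSq_mul_mul {n : Type*} [Fintype n] [DecidableEq n] {X Y : Matrix n n ℂ}
    (hX : X.conjTranspose * X = 1) (hY : Y * Y.conjTranspose = 1) (A : Matrix n n ℂ) :
    hsNormSq (X * A * Y) = hsNormSq A := by
  have h : (hsNormSq (X * A * Y) : ℂ) = hsNormSq A := by
    rw [hsNormSq_eq_trace, hsNormSq_eq_trace]
    calc _ = (Y.conjTranspose * (A.conjTranspose * (X.conjTranspose * X) * A * Y)).trace := by
          simp only [Matrix.conjTranspose_mul, Matrix.mul_assoc]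
      _ = _ := by
          rw [Matrix.trace_mul_comm, hX, Matrix.mul_one, Matrix.mul_assoc _ Y, hY, Matrix.mul_one]
  exact_mod_cast h

lemma frobNorm_eq (A : Matrix (Fin d) (Fin d) ℂ) : frobNorm A = Real.sqrt (hsNormSq A) := rfl

instance : (haarU d).IsHaarMeasure := by
  unfold haarU; infer_instance

instance : MeasureTheory.IsProbabilityMeasure (haarU d) :=
  ⟨MeasureTheory.Measure.haarMeasure_self (K₀ := ⊤)⟩

/-- The Haar measure of a compact group is also right invariant. -/
instance : (haarU d).IsMulRightInvariant where
  map_mul_right_eq_self g := by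
    have hp : MeasureTheory.IsProbabilityMeasure ((haarU d).map (· * g)) :=
      MeasureTheory.Measure.isProbabilityMeasure_map (by fun_prop)
    exact MeasureTheory.Measure.isHaarMeasure_eq_of_isProbabilityMeasure _ _

lemma transpose_mem_unitaryGroup (U : UGroup d) :
    (U : Matrix (Fin d) (Fin d) ℂ).transpose ∈ Matrix.unitaryGroup (Fin d) ℂ := by
  rw [Matrix.mem_unitaryGroup_iff', Matrix.star_eq_conjTranspose]
  change (U : Matrix (Fin d) (Fin d) ℂ).conjTranspose.transpose * _ = 1
  rw [← Matrix.transpose_mul, mul_conjTranspose_self_coe, Matrix.transpose_one]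

lemma conj_eq_of_mem_centralizerU {O : Matrix (Fin d) (Fin d) ℂ} (V : centralizerU O) :
    ((V : UGroup d) : Matrix (Fin d) (Fin d) ℂ).conjTranspose * O * (V : UGroup d) = O := by
  have h : ((V : UGroup d) : Matrix (Fin d) (Fin d) ℂ) * O = O * (V : UGroup d) := V.2
  rw [Matrix.mul_assoc, ← h, ← Matrix.mul_assoc, conjTranspose_mul_self_coe, Matrix.one_mul]

lemma conj_eq_of_mem_centralizerU' {O : Matrix (Fin d) (Fin d) ℂ} (V : centralizerU O) :
    ((V : UGroup d) : Matrix (Fin d) (Fin d) ℂ) * O *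
      ((V : UGroup d) : Matrix (Fin d) (Fin d) ℂ).conjTranspose = O := by
  have h : ((V : UGroup d) : Matrix (Fin d) (Fin d) ℂ) * O = O * (V : UGroup d) := V.2
  rw [h, Matrix.mul_assoc, mul_conjTranspose_self_coe, Matrix.mul_one]

/-- The conjugation by `A ⊗ V^{⊗ t} ⊗ A^{⊗ t} ⊗ W` amounts to the substitution `U ↦ Aᵀ U V` under
the Haar integral. -/
lemma objective_conj_localOp {O : Matrix (Fin d) (Fin d) ℂ} (A : UGroup d) (V W : centralizerU O)
    (C : CombOp d t) :
    objective O (localOp t (A : Matrix (Fin d) (Fin d) ℂ) (V : UGroup d) (W : UGroup d) * C *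
      (localOp t (A : Matrix (Fin d) (Fin d) ℂ) (V : UGroup d) (W : UGroup d)).conjTranspose) =
        objective O C := by
  -- the integrand for the conjugated comb at `U` is that for `C` at `Aᵀ * (U * V)`
  let A' : UGroup d := ⟨_, transpose_mem_unitaryGroup A⟩
  have hA1 : (A : Matrix (Fin d) (Fin d) ℂ).transpose.conjTranspose *
      (A : Matrix (Fin d) (Fin d) ℂ).transpose = 1 := conjTranspose_mul_self_coe A'
  have hA2 : (A : Matrix (Fin d) (Fin d) ℂ).transpose *
      (A : Matrix (Fin d) (Fin d) ℂ).transpose.conjTranspose = 1 := mul_conjTranspose_self_coe A'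
  rw [objective_eq, objective_eq]
  let h : UGroup d → ℝ := fun U => frobNorm (combOutput O C U -
      (U : Matrix (Fin d) (Fin d) ℂ) * O * star (U : Matrix (Fin d) (Fin d) ℂ))
  have hpt : ∀ U : UGroup d, frobNorm (combOutput O (localOp t (A : Matrix (Fin d) (Fin d) ℂ)
      (V : UGroup d) (W : UGroup d) * C * (localOp t (A : Matrix (Fin d) (Fin d) ℂ) (V : UGroup d)
        (W : UGroup d)).conjTranspose) U - (U : Matrix (Fin d) (Fin d) ℂ) * O *
          star (U : Matrix (Fin d) (Fin d) ℂ)) = h (A' * (U * (V : UGroup d))) := by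
    intro U
    have hU : ((A' * (U * (V : UGroup d)) : UGroup d) : Matrix (Fin d) (Fin d) ℂ) =
        (A : Matrix (Fin d) (Fin d) ℂ).transpose * U * (V : UGroup d) := by
      simp [A', Matrix.mul_assoc]
    have h1 : (U : Matrix (Fin d) (Fin d) ℂ) * O * star (U : Matrix (Fin d) (Fin d) ℂ) =
        (A : Matrix (Fin d) (Fin d) ℂ).transpose.conjTranspose *
          (((A : Matrix (Fin d) (Fin d) ℂ).transpose * U * (V : UGroup d)) * O *
            star ((A : Matrix (Fin d) (Fin d) ℂ).transpose * U * (V : UGroup d))) *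
              (A : Matrix (Fin d) (Fin d) ℂ).transpose := by
      simp only [Matrix.star_eq_conjTranspose]
      calc _ = ((A : Matrix (Fin d) (Fin d) ℂ).transpose.conjTranspose *
          (A : Matrix (Fin d) (Fin d) ℂ).transpose) * U * (((V : UGroup d) :
            Matrix (Fin d) (Fin d) ℂ) * O * ((V : UGroup d) :
            Matrix (Fin d) (Fin d) ℂ).conjTranspose) *
              (U : Matrix (Fin d) (Fin d) ℂ).conjTranspose *
            ((A : Matrix (Fin d) (Fin d) ℂ).transpose.conjTranspose *
              (A : Matrix (Fin d) (Fin d) ℂ).transpose) := by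
            rw [hA1, conj_eq_of_mem_centralizerU', Matrix.one_mul, Matrix.mul_one]
        _ = _ := by simp only [Matrix.conjTranspose_mul, Matrix.mul_assoc]
    simp only [h]
    rw [combOutput_conj_localOp (conj_eq_of_mem_centralizerU W), hU]
    conv_lhs => rw [h1]
    rw [← Matrix.sub_mul, ← Matrix.mul_sub, frobNorm_eq, frobNorm_eq,
      hsNormSq_mul_mul (by rw [Matrix.conjTranspose_conjTranspose, hA2]) hA2]
  simp only [hpt]
  rw [MeasureTheory.integral_mul_right_eq_self (fun U => h (A' * U)),
    MeasureTheory.integral_mul_left_eq_self h]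

end Invariance

/-! ### The feasible set is invariant, convex and compact -/

section FeasibleSet

/-- The partial trace over the second factor. -/
def trSnd {m n : Type*} [Fintype n] (M : Matrix (m × n) (m × n) ℂ) : Matrix m m ℂ :=
  Matrix.of fun a b => ∑ k, M (a, k) (b, k)

lemma trSnd_kronecker_conj {m n : Type*} [Fintype m] [Fintype n] [DecidableEq n]
    (X : Matrix m m ℂ) {Y : Matrix n n ℂ} (hY : Y.conjTranspose * Y = 1)
    (M : Matrix (m × n) (m × n) ℂ) :
    trSnd ((X ⊗ₖ Y) * M * (X ⊗ₖ Y).conjTranspose) = X * trSnd M * X.conjTranspose := by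
  ext a b
  have h : ∀ k l, ∑ j, Y j k * star (Y j l) = if k = l then 1 else 0 := by
    intro k l
    have := congrFun (congrFun hY l) k
    simp only [Matrix.mul_apply, Matrix.conjTranspose_apply, Matrix.one_apply] at this
    simp only [mul_comm (Y _ k), this, eq_comm]
  calc trSnd ((X ⊗ₖ Y) * M * (X ⊗ₖ Y).conjTranspose) a b
      = ∑ j, ∑ b', ∑ l, ∑ a', ∑ k, X a a' * M (a', k) (b', l) * star (X b b') *
          (Y j k * star (Y j l)) := by
        simp only [trSnd, Matrix.of_apply, Matrix.mul_apply, Matrix.conjTranspose_apply,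
          Matrix.kroneckerMap_apply, Fintype.sum_prod_type, Finset.sum_mul, star_mul']
        refine Finset.sum_congr rfl fun j _ => Finset.sum_congr rfl fun b' _ =>
          Finset.sum_congr rfl fun l _ => Finset.sum_congr rfl fun a' _ =>
          Finset.sum_congr rfl fun k _ => by ring
    _ = ∑ b', ∑ l, ∑ a', ∑ k, X a a' * M (a', k) (b', l) * star (X b b') *
          ∑ j, (Y j k * star (Y j l)) := by
        simp only [Finset.mul_sum]
        rw [sum_comm_three]
        refine Finset.sum_congr rfl fun b' _ => Finset.sum_congr rfl fun l _ => ?_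
        exact sum_comm_three _
    _ = _ := by
        simp only [h, mul_ite, mul_one, mul_zero, Finset.sum_ite_eq', Finset.mem_univ, if_true,
          trSnd, Matrix.of_apply, Matrix.mul_apply, Matrix.conjTranspose_apply, Finset.sum_mul,
          Finset.mul_sum]
        exact Finset.sum_congr rfl fun _ _ => Finset.sum_comm

variable {d t : ℕ}

/-- Bracketing of the systems as `((P, I), O), F`. -/
def bracketF (d t : ℕ) : ((Fin d × (Fin t → Fin d)) × (Fin t → Fin d)) × Fin d ≃ Idx d t where
  toFun x := (x.1.1.1, x.1.1.2, x.1.2, x.2)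
  invFun x := (((x.1, x.2.1), x.2.2.1), x.2.2.2)

lemma trF_eq_trSnd (C : CombOp d t) :
    trF C = trSnd (C.submatrix (bracketF d t) (bracketF d t)) := rfl

lemma trOF_eq_trSnd (C : CombOp d t) : trOF C = trSnd (trF C) := rfl

lemma trIOF_eq_trSnd (C : CombOp d t) : trIOF C = trSnd C := by
  ext p q
  simp only [trIOF, trSnd, Matrix.of_apply, Fintype.sum_prod_type]

lemma localOp_submatrix_bracketF (A V W : Matrix (Fin d) (Fin d) ℂ) :
    (localOp t A V W).submatrix (bracketF d t) (bracketF d t) =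
      ((A ⊗ₖ tensorOp (fun _ : Fin t => V)) ⊗ₖ tensorOp (fun _ : Fin t => A)) ⊗ₖ W := by
  ext x y
  simp [localOp, bracketF, Matrix.kroneckerMap_apply, mul_assoc]

lemma conjTranspose_tensorOp_mul_self (A : UGroup d) :
    (tensorOp (fun _ : Fin t => (A : Matrix (Fin d) (Fin d) ℂ))).conjTranspose *
      tensorOp (fun _ : Fin t => (A : Matrix (Fin d) (Fin d) ℂ)) = 1 := by
  simp only [conjTranspose_tensorOp, tensorOp_mul, conjTranspose_mul_self_coe, tensorOp_one]

lemma tensorOp_mul_conjTranspose_self (A : UGroup d) :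
    tensorOp (fun _ : Fin t => (A : Matrix (Fin d) (Fin d) ℂ)) *
      (tensorOp (fun _ : Fin t => (A : Matrix (Fin d) (Fin d) ℂ))).conjTranspose = 1 := by
  simp only [conjTranspose_tensorOp, tensorOp_mul, mul_conjTranspose_self_coe, tensorOp_one]

lemma trF_conj_localOp (A V W : UGroup d) (C : CombOp d t) :
    trF (localOp t (A : Matrix (Fin d) (Fin d) ℂ) V W * C * (localOp t A V W).conjTranspose) =
      (((A : Matrix (Fin d) (Fin d) ℂ) ⊗ₖ tensorOp (fun _ : Fin t => V)) ⊗ₖ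
        tensorOp (fun _ : Fin t => A)) * trF C *
      (((A : Matrix (Fin d) (Fin d) ℂ) ⊗ₖ tensorOp (fun _ : Fin t => V)) ⊗ₖ
        tensorOp (fun _ : Fin t => A)).conjTranspose := by
  rw [trF_eq_trSnd, ← Matrix.submatrix_mul_equiv _ _ _ (bracketF d t),
    ← Matrix.submatrix_mul_equiv _ _ _ (bracketF d t), ← Matrix.conjTranspose_submatrix,
    localOp_submatrix_bracketF, trSnd_kronecker_conj _ (conjTranspose_mul_self_coe W),
    trF_eq_trSnd]

/-- Conjugation by local unitaries preserves the feasible set. -/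
lemma Feasible.conj_localOp {C : CombOp d t} (hC : Feasible C) (A V W : UGroup d) :
    Feasible (localOp t (A : Matrix (Fin d) (Fin d) ℂ) V W * C *
      (localOp t (A : Matrix (Fin d) (Fin d) ℂ) V W).conjTranspose) := by
  have htr : (localOp t (A : Matrix (Fin d) (Fin d) ℂ) V W * C *
      (localOp t (A : Matrix (Fin d) (Fin d) ℂ) V W).conjTranspose).trace = C.trace := by
    rw [Matrix.trace_mul_comm, ← Matrix.mul_assoc, conjTranspose_localOp_mul_self, Matrix.one_mul]
  refine ⟨hC.posSemidef.mul_mul_conjTranspose_same _, ?_, ?_, ?_⟩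
  · rw [trOF_eq_trSnd, trF_conj_localOp, trSnd_kronecker_conj _ (conjTranspose_tensorOp_mul_self A),
      ← trOF_eq_trSnd]
    conv_lhs => rw [hC.trF_eq]
    rw [Matrix.conjTranspose_kronecker, ← Matrix.mul_kronecker_mul, ← Matrix.mul_kronecker_mul,
      Matrix.mul_smul, Matrix.smul_mul, Matrix.mul_one, tensorOp_mul_conjTranspose_self]
  · rw [htr, trIOF_eq_trSnd, localOp, trSnd_kronecker_conj, ← trIOF_eq_trSnd, hC.trIOF_eq,
      Matrix.mul_smul, Matrix.smul_mul, Matrix.mul_smul, Matrix.smul_mul, Matrix.mul_one,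
      mul_conjTranspose_self_coe]
    simp only [Matrix.conjTranspose_kronecker, ← Matrix.mul_kronecker_mul,
      conjTranspose_tensorOp_mul_self, conjTranspose_mul_self_coe, Matrix.one_kronecker_one]
  · rw [htr, hC.trace_eq]

lemma feasible_iff (C : CombOp d t) : Feasible C ↔ C.PosSemidef ∧
    trF C = trOF C ⊗ₖ (((d : ℂ) ^ t)⁻¹ • (1 : Matrix (Fin t → Fin d) (Fin t → Fin d) ℂ)) ∧
    trIOF C = C.trace • ((d : ℂ)⁻¹ • (1 : Matrix (Fin d) (Fin d) ℂ)) ∧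
    C.trace = (d : ℂ) * (d : ℂ) ^ t :=
  ⟨fun h => ⟨h.1, h.2, h.3, h.4⟩, fun h => ⟨h.1, h.2.1, h.2.2.1, h.2.2.2⟩⟩

lemma trF_combination (a b : ℝ) (C D : CombOp d t) :
    trF (a • C + b • D) = a • trF C + b • trF D := by
  ext x y
  simp [trF, Finset.sum_add_distrib, Finset.mul_sum]

lemma trOF_combination (a b : ℝ) (C D : CombOp d t) :
    trOF (a • C + b • D) = a • trOF C + b • trOF D := by
  ext x y
  simp [trOF, Finset.sum_add_distrib, Finset.mul_sum]

lemma trIOF_combination (a b : ℝ) (C D : CombOp d t) :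
    trIOF (a • C + b • D) = a • trIOF C + b • trIOF D := by
  ext x y
  simp [trIOF, Finset.sum_add_distrib, Finset.mul_sum]

lemma convex_feasible : Convex ℝ {C : CombOp d t | Feasible C} := by
  intro C hC D hD a b ha hb hab
  have hC : Feasible C := hC
  have hD : Feasible D := hD
  have htr : (a • C + b • D).trace = (d : ℂ) * (d : ℂ) ^ t := by
    rw [Matrix.trace_add, Matrix.trace_smul, Matrix.trace_smul, hC.trace_eq, hD.trace_eq,
      ← add_smul, hab, one_smul]
  refine ⟨(hC.posSemidef.smul ha).add (hD.posSemidef.smul hb), ?_, ?_, htr⟩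
  · rw [trF_combination, trOF_combination, hC.trF_eq, hD.trF_eq, Matrix.add_kronecker,
      Matrix.smul_kronecker, Matrix.smul_kronecker]
  · rw [htr, trIOF_combination, hC.trIOF_eq, hD.trIOF_eq, hC.trace_eq, hD.trace_eq,
      ← add_smul, hab, one_smul]

lemma isClosed_posSemidef {n : Type*} [Fintype n] : IsClosed {C : Matrix n n ℂ | C.PosSemidef} := by
  simp only [Matrix.posSemidef_iff_dotProduct_mulVec, Set.ofPred_and, Set.ofPred_forall]
  refine IsClosed.inter (isClosed_eq (by fun_prop) continuous_id) (isClosed_iInter fun x => ?_)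
  exact isClosed_le continuous_const (by fun_prop)

lemma isClosed_feasible : IsClosed {C : CombOp d t | Feasible C} := by
  simp only [feasible_iff, Set.ofPred_and]
  refine isClosed_posSemidef.inter (IsClosed.inter ?_ (IsClosed.inter ?_ ?_))
  · refine isClosed_eq ?_ ?_
    · refine continuous_matrix fun x y => ?_
      simp only [trF, Matrix.of_apply]; fun_prop
    · refine continuous_matrix fun x y => ?_
      simp only [trOF, Matrix.kroneckerMap_apply, Matrix.of_apply]; fun_prop
  · refine isClosed_eq ?_ ?_
    · refine continuous_matrix fun x y => ?_
      simp only [trIOF, Matrix.of_apply]; fun_prop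
    · fun_prop
  · exact isClosed_eq (by fun_prop) continuous_const

/-- The entries of a positive semidefinite matrix are bounded by its trace. -/
lemma norm_apply_le_trace {n : Type*} [Fintype n] {C : Matrix n n ℂ} (hC : C.PosSemidef)
    (i j : n) : ‖C i j‖ ≤ C.trace.re := by
  classical
  obtain ⟨m, rfl⟩ : ∃ m : Matrix n n ℂ, C = m.conjTranspose * m := by
    open scoped MatrixOrder Matrix.Norms.L2Operator in
    exact CStarAlgebra.nonneg_iff_eq_star_mul_self.mp hC.nonneg
  rw [← hsNormSq_eq_trace, Complex.ofReal_re, hsNormSq, Finset.sum_comm]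
  have hcol : ∀ k, ∑ l, ‖m l k‖ ^ 2 ≤ ∑ k, ∑ l, ‖m l k‖ ^ 2 := fun k =>
    Finset.single_le_sum (f := fun k => ∑ l, ‖m l k‖ ^ 2)
      (fun _ _ => Finset.sum_nonneg fun _ _ => sq_nonneg _) (Finset.mem_univ k)
  calc ‖(m.conjTranspose * m) i j‖ ≤ ∑ l, ‖m l i‖ * ‖m l j‖ := by
        rw [Matrix.mul_apply]
        refine (norm_sum_le _ _).trans (le_of_eq (Finset.sum_congr rfl fun l _ => ?_))
        rw [norm_mul, Matrix.conjTranspose_apply, norm_star]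
    _ ≤ ∑ l, (‖m l i‖ ^ 2 + ‖m l j‖ ^ 2) / 2 :=
        Finset.sum_le_sum fun l _ => by nlinarith [sq_nonneg (‖m l i‖ - ‖m l j‖)]
    _ = (∑ l, ‖m l i‖ ^ 2 + ∑ l, ‖m l j‖ ^ 2) / 2 := by
        rw [← Finset.sum_div, Finset.sum_add_distrib]
    _ ≤ _ := by linarith [hcol i, hcol j]

lemma isCompact_feasible : IsCompact {C : CombOp d t | Feasible C} := by
  have hball : IsCompact (Set.pi Set.univ (fun _ : Idx d t => Set.pi Set.univ
      (fun _ : Idx d t => Metric.closedBall (0 : ℂ) ((d : ℂ) * (d : ℂ) ^ t).re))) :=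
    isCompact_univ_pi fun _ => isCompact_univ_pi fun _ => isCompact_closedBall _ _
  refine hball.of_isClosed_subset isClosed_feasible ?_
  intro C hC
  have hC : Feasible C := hC
  simp only [Set.mem_pi, Set.mem_univ, true_implies, mem_closedBall_zero_iff]
  intro i j
  rw [← hC.trace_eq]
  exact norm_apply_le_trace hC.posSemidef i j

/-- The completely depolarising comb is feasible. -/
lemma exists_feasible (hd : 0 < d) : ∃ C : CombOp d t, Feasible C := by
  have hd' : (d : ℂ) ≠ 0 := by exact_mod_cast hd.ne'
  have htr : ((((d : ℝ) * (d : ℝ) ^ t)⁻¹ : ℝ) • (1 : CombOp d t)).trace =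
      (d : ℂ) * (d : ℂ) ^ t := by
    rw [Matrix.trace_smul, Matrix.trace_one]
    simp only [Fintype.card_prod, Fintype.card_fin, Fintype.card_pi, Finset.prod_const,
      Finset.card_univ]
    rw [Complex.real_smul]
    push_cast
    field_simp
  refine ⟨(((d : ℝ) * (d : ℝ) ^ t)⁻¹ : ℝ) • 1, ⟨Matrix.PosSemidef.one.smul (by positivity), ?_,
    ?_, htr⟩⟩
  · ext ⟨⟨p, i⟩, o⟩ ⟨⟨q, j⟩, o'⟩
    simp only [trF, trOF, Matrix.of_apply, Matrix.smul_apply, Matrix.kroneckerMap_apply,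
      Matrix.one_apply, Prod.mk.injEq, smul_eq_mul, Complex.real_smul]
    by_cases h1 : p = q <;> by_cases h2 : i = j <;> by_cases h3 : o = o' <;>
      simp [h1, h2, h3]
    field_simp
  · rw [htr]
    ext p q
    simp only [trIOF, Matrix.of_apply, Matrix.smul_apply, Matrix.one_apply, Prod.mk.injEq,
      smul_eq_mul, Complex.real_smul]
    by_cases h1 : p = q <;> simp [h1]
    field_simp

end FeasibleSet

/-! ### Convexity and continuity of the objective -/

section Convexity

variable {d t : ℕ}

open scoped Matrix.Norms.Frobenius in
lemma frobNorm_add_le (A B : Matrix (Fin d) (Fin d) ℂ) :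
    frobNorm (A + B) ≤ frobNorm A + frobNorm B := by
  have h : ∀ A : Matrix (Fin d) (Fin d) ℂ, frobNorm A = ‖A‖ := fun A => by
    rw [Matrix.frobenius_norm_def, frobNorm, Real.sqrt_eq_rpow]
    simp
  rw [h, h, h]
  exact norm_add_le A B

lemma frobNorm_smul {a : ℝ} (ha : 0 ≤ a) (A : Matrix (Fin d) (Fin d) ℂ) :
    frobNorm (a • A) = a * frobNorm A := by
  simp only [frobNorm, Matrix.smul_apply, norm_smul, Real.norm_eq_abs, mul_pow, sq_abs,
    ← Finset.mul_sum]
  rw [Real.sqrt_mul (sq_nonneg a), Real.sqrt_sq ha]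

lemma combOutput_combination (O : Matrix (Fin d) (Fin d) ℂ) (a b : ℝ) (C D : CombOp d t)
    (U : Matrix (Fin d) (Fin d) ℂ) :
    combOutput O (a • C + b • D) U = a • combOutput O C U + b • combOutput O D U := by
  ext q p
  simp only [combOutput_apply, Matrix.add_apply, Matrix.smul_apply, add_mul, smul_mul_assoc,
    Finset.sum_add_distrib, Finset.smul_sum]

/-- The integrand of the objective. -/
noncomputable def deviation (O : Matrix (Fin d) (Fin d) ℂ) (C : CombOp d t) (U : UGroup d) : ℝ :=
  frobNorm (combOutput O C U -
    (U : Matrix (Fin d) (Fin d) ℂ) * O * star (U : Matrix (Fin d) (Fin d) ℂ))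

lemma continuous_deviation (O : Matrix (Fin d) (Fin d) ℂ) :
    Continuous (Function.uncurry (deviation (t := t) O)) := by
  have hS : Continuous fun x : CombOp d t × UGroup d =>
      slotContraction t (x.2 : Matrix (Fin d) (Fin d) ℂ) := by
    refine continuous_matrix fun u x => ?_
    simp only [slotContraction, Matrix.of_apply]
    have he : ∀ a b, Continuous fun x : CombOp d t × UGroup d =>
        (x.2 : Matrix (Fin d) (Fin d) ℂ) a b := fun a b =>
      (continuous_subtype_val.comp continuous_snd).matrix_elem a b
    exact (continuous_const.mul (continuous_finsetProd _ fun l _ => he _ _)).mul continuous_const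
  have hM : Continuous fun x : CombOp d t × UGroup d =>
      combOutput O x.1 x.2 -
        (x.2 : Matrix (Fin d) (Fin d) ℂ) * O * star (x.2 : Matrix (Fin d) (Fin d) ℂ) := by
    refine Continuous.sub ?_ (by fun_prop)
    refine continuous_matrix fun q p => ?_
    simp only [combOutput, contractF, Matrix.of_apply]
    fun_prop
  change Continuous fun x : CombOp d t × UGroup d => Real.sqrt (∑ i, ∑ j, ‖(combOutput O x.1 x.2 -
    (x.2 : Matrix (Fin d) (Fin d) ℂ) * O * star (x.2 : Matrix (Fin d) (Fin d) ℂ)) i j‖ ^ 2)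
  fun_prop

lemma objective_eq_integral_deviation (O : Matrix (Fin d) (Fin d) ℂ) (C : CombOp d t) :
    objective O C = ∫ U, deviation O C U ∂(haarU d) := objective_eq O C

lemma integrable_deviation (O : Matrix (Fin d) (Fin d) ℂ) (C : CombOp d t) :
    MeasureTheory.Integrable (deviation O C) (haarU d) := by
  have h : Continuous fun U => Function.uncurry (deviation O) (C, U) :=
    (continuous_deviation O).comp (Continuous.prodMk_right C)
  exact h.integrable_of_hasCompactSupport (HasCompactSupport.of_compactSpace _)

lemma continuous_objective (O : Matrix (Fin d) (Fin d) ℂ) :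
    Continuous fun C : CombOp d t => objective O C := by
  have : LocallyCompactSpace (CombOp d t) :=
    inferInstanceAs (LocallyCompactSpace (Idx d t → Idx d t → ℂ))
  have : FirstCountableTopology (CombOp d t) :=
    inferInstanceAs (FirstCountableTopology (Idx d t → Idx d t → ℂ))
  have h := continuous_parametric_integral_of_continuous (μ := haarU d)
    (continuous_deviation (t := t) O) isCompact_univ
  simpa only [objective_eq_integral_deviation, MeasureTheory.Measure.restrict_univ] using h

lemma objective_combination_le (O : Matrix (Fin d) (Fin d) ℂ) (C D : CombOp d t) {a b : ℝ}
    (ha : 0 ≤ a) (hb : 0 ≤ b) (hab : a + b = 1) :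
    objective O (a • C + b • D) ≤ a * objective O C + b * objective O D := by
  simp only [objective_eq_integral_deviation]
  rw [← MeasureTheory.integral_const_mul, ← MeasureTheory.integral_const_mul,
    ← MeasureTheory.integral_add ((integrable_deviation O C).const_mul a)
      ((integrable_deviation O D).const_mul b)]
  refine MeasureTheory.integral_mono (integrable_deviation O _)
    (((integrable_deviation O C).const_mul a).add ((integrable_deviation O D).const_mul b))
    fun U => ?_
  have h : ∀ X : Matrix (Fin d) (Fin d) ℂ, X = a • X + b • X := fun X => by
    rw [← add_smul, hab, one_smul]
  simp only [deviation]
  rw [combOutput_combination, h ((U : Matrix (Fin d) (Fin d) ℂ) * O * star _), add_sub_add_comm,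
    ← smul_sub, ← smul_sub, ← frobNorm_smul ha, ← frobNorm_smul hb, ← h]
  exact frobNorm_add_le _ _

/-! ### Symmetrisation -/

/-- The parallelogram law. -/
lemma hsNormSq_midpoint {n : Type*} [Fintype n] (A B : Matrix n n ℂ) :
    hsNormSq ((1 / 2 : ℝ) • A + (1 / 2 : ℝ) • B) + hsNormSq (A - B) / 4 =
      (hsNormSq A + hsNormSq B) / 2 := by
  simp only [hsNormSq, ← Finset.sum_add_distrib, Finset.sum_div]
  refine Finset.sum_congr rfl fun i _ => Finset.sum_congr rfl fun j _ => ?_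
  simp only [Matrix.add_apply, Matrix.sub_apply, Matrix.smul_apply, Complex.sq_norm,
    Complex.normSq_apply, Complex.real_smul, Complex.add_re, Complex.add_im, Complex.sub_re,
    Complex.sub_im, Complex.mul_re, Complex.mul_im, Complex.ofReal_re, Complex.ofReal_im]
  ring

lemma eq_of_hsNormSq_sub_nonpos {n : Type*} [Fintype n] {A B : Matrix n n ℂ}
    (h : hsNormSq (A - B) ≤ 0) : A = B := by
  have h0 : hsNormSq (A - B) = 0 := le_antisymm h <|
    Finset.sum_nonneg fun _ _ => Finset.sum_nonneg fun _ _ => sq_nonneg _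
  ext i j
  have h1 := (Finset.sum_eq_zero_iff_of_nonneg fun _ _ =>
    Finset.sum_nonneg fun _ _ => sq_nonneg _).1 h0 i (Finset.mem_univ i)
  have h2 := (Finset.sum_eq_zero_iff_of_nonneg fun _ _ => sq_nonneg _).1 h1 j (Finset.mem_univ j)
  simpa [sub_eq_zero] using h2

/-- The feasible points that are at least as good as `C` form a compact convex set
stable under conjugation by local unitaries. Its unique element of smallest Hilbert–Schmidt
norm is therefore symmetric; this replaces an average over the group. -/
lemma exists_symmetric_le (O : Matrix (Fin d) (Fin d) ℂ) {C : CombOp d t} (hC : Feasible C) :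
    ∃ C' : CombOp d t, Feasible C' ∧ Symmetric O C' ∧ objective O C' ≤ objective O C := by
  have hK : IsCompact ({D : CombOp d t | Feasible D} ∩ {D | objective O D ≤ objective O C}) :=
    isCompact_feasible.inter_right (isClosed_le (continuous_objective O) continuous_const)
  have hN : Continuous (hsNormSq : CombOp d t → ℝ) := by
    unfold hsNormSq
    fun_prop
  obtain ⟨D, ⟨hD, hDC⟩, hmin⟩ := hK.exists_isMinOn ⟨C, hC, le_refl (objective O C)⟩ hN.continuousOn
  have hD : Feasible D := hD
  have hDC : objective O D ≤ objective O C := hDC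
  refine ⟨D, hD, ?_, hDC⟩
  rw [symmetric_iff]
  intro U V W
  set E := localOp t (U : Matrix (Fin d) (Fin d) ℂ) (V : UGroup d) (W : UGroup d) * D *
    (localOp t (U : Matrix (Fin d) (Fin d) ℂ) (V : UGroup d) (W : UGroup d)).conjTranspose with hE
  have hEf : Feasible E := hD.conj_localOp U V W
  have hEo : objective O E = objective O D := objective_conj_localOp U V W D
  have hEn : hsNormSq E = hsNormSq D := by
    have h := conjTranspose_localOp_mul_self (t := t) U (V : UGroup d) (W : UGroup d)
    exact hsNormSq_mul_mul h (by rw [Matrix.conjTranspose_conjTranspose, h]) D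
  have hmid : hsNormSq D ≤ hsNormSq ((1 / 2 : ℝ) • E + (1 / 2 : ℝ) • D) := by
    refine hmin ⟨convex_feasible hEf hD (by norm_num) (by norm_num) (by norm_num), ?_⟩
    have := objective_combination_le O E D (a := 1 / 2) (b := 1 / 2) (by norm_num) (by norm_num)
      (by norm_num)
    simp only [Set.mem_ofPred_eq]
    linarith
  refine eq_of_hsNormSq_sub_nonpos ?_
  have := hsNormSq_midpoint E D
  linarith

end Convexity

/-! ### Existence of a Schur basis -/

section UnitaryDecomposition

variable {G X : Type*} [Group G] [Fintype X] [DecidableEq X]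

/-- An irreducible constituent of a matrix representation `R`: a matrix with orthonormal columns
that intertwines an irreducible representation on `ℂ^k` with `R`. -/
structure IrrepFrame (R : G →* Matrix X X ℂ) where
  /-- The dimension. -/
  k : ℕ
  /-- The irreducible representation. -/
  irrep : Representation ℂ G (Fin k → ℂ)
  irreducible : irrep.IsIrreducible
  /-- The matrix of the isometric embedding. -/
  mat : Matrix X (Fin k) ℂ
  isometry : mat.conjTranspose * mat = 1
  intertwines : ∀ g, R g * mat = mat * LinearMap.toMatrix' (irrep g)

variable {R : G →* Matrix X X ℂ}

lemma IrrepFrame.k_pos (F : IrrepFrame R) : 0 < F.k := by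
  by_contra h
  have h0 : F.k = 0 := by omega
  have : IsEmpty (Fin F.k) := by rw [h0]; infer_instance
  obtain ⟨x, y, hxy⟩ := F.irreducible.exists_pair_ne
  exact hxy (Subrepresentation.toSubmodule_injective (Subsingleton.elim _ _))

/-- Every subspace of `ℂ^X` has an orthonormal basis, given by the columns of a matrix. -/
lemma exists_orthonormal_matrix {X : Type*} [Fintype X] (V : Submodule ℂ (X → ℂ)) :
    ∃ (k : ℕ) (b : Matrix X (Fin k) ℂ), b.conjTranspose * b = 1 ∧
      (∀ w, b.mulVec w ∈ V) ∧ ∀ v ∈ V, b.mulVec (b.conjTranspose.mulVec v) = v := by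
  let V' : Submodule ℂ (EuclideanSpace ℂ X) := V.comap (WithLp.linearEquiv 2 ℂ (X → ℂ)).toLinearMap
  let e := stdOrthonormalBasis ℂ V'
  let b : Matrix X (Fin (Module.finrank ℂ V')) ℂ :=
    Matrix.of fun x a => (e a : EuclideanSpace ℂ X) x
  have hinner : ∀ (a) (v : EuclideanSpace ℂ X),
      inner ℂ (e a : EuclideanSpace ℂ X) v = (b.conjTranspose.mulVec v.ofLp) a := by
    intro a v
    simp [PiLp.inner_apply, b, Matrix.mulVec, dotProduct, mul_comm]
  have hsum : ∀ w : Fin (Module.finrank ℂ V') → ℂ,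
      WithLp.toLp 2 (b.mulVec w) = ((∑ a, w a • e a : V') : EuclideanSpace ℂ X) := by
    intro w
    ext x
    simp [b, Matrix.mulVec, dotProduct, mul_comm]
  refine ⟨_, b, ?_, ?_, ?_⟩
  · ext a c
    have h := orthonormal_iff_ite.1 e.orthonormal a c
    rw [Submodule.coe_inner, hinner] at h
    rw [Matrix.one_apply, ← h]
    rfl
  · intro w
    have h : WithLp.toLp 2 (b.mulVec w) ∈ V' := by
      rw [hsum]; exact (∑ a, w a • e a : V').2
    exact h
  · intro v hv
    let v' : V' := ⟨WithLp.toLp 2 v, hv⟩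
    have h := e.sum_repr' v'
    have h2 : b.conjTranspose.mulVec v = fun a => inner ℂ (e a) v' := by
      ext a
      rw [Submodule.coe_inner, hinner]
    apply WithLp.toLp_injective 2
    rw [h2, hsum, h]

/-- A nonzero invariant subspace contains an irreducible constituent, obtained from
a minimal nonzero invariant subspace. -/
lemma exists_irrepFrame {K : Submodule ℂ (X → ℂ)} (hK : K ≠ ⊥)
    (hinv : ∀ g, ∀ v ∈ K, (R g).mulVec v ∈ K) :
    ∃ F : IrrepFrame R, ∀ w, F.mat.mulVec w ∈ K := by
  obtain ⟨V, ⟨hV0, hVinv, hVK⟩, hmin⟩ := (wellFounded_lt (α := Submodule ℂ (X → ℂ))).has_min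
    {V | V ≠ ⊥ ∧ (∀ g, ∀ v ∈ V, (R g).mulVec v ∈ V) ∧ V ≤ K} ⟨K, hK, hinv, le_rfl⟩
  obtain ⟨k, b, hb, hbV, hVb⟩ := exists_orthonormal_matrix V
  -- `b bᴴ` is the identity on the invariant subspace `V`
  have hint : ∀ g, b * (b.conjTranspose * R g * b) = R g * b := by
    intro g
    refine Matrix.toLin'.injective (LinearMap.ext fun w => ?_)
    simp only [Matrix.toLin'_apply, ← Matrix.mulVec_mulVec]
    exact hVb _ (hVinv g _ (hbV w))
  let M : Representation ℂ G (Fin k → ℂ) :=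
    { toFun := fun g => Matrix.toLin' (b.conjTranspose * R g * b)
      map_one' := by
        rw [map_one, Matrix.mul_one, hb, Matrix.toLin'_one]
        rfl
      map_mul' := fun g h => by
        refine Eq.trans (congrArg _ ?_) (Matrix.toLin'_mul _ _)
        rw [Matrix.mul_assoc (_ * R g), hint, map_mul]
        simp only [Matrix.mul_assoc] }
  have hMv : ∀ g w, b.mulVec (M g w) = (R g).mulVec (b.mulVec w) := by
    intro g w
    change b.mulVec ((b.conjTranspose * R g * b).mulVec w) = _
    rw [Matrix.mulVec_mulVec, hint, Matrix.mulVec_mulVec]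
  have hbinj : ∀ w w', b.mulVec w = b.mulVec w' → w = w' := by
    intro w w' h
    have := congrArg b.conjTranspose.mulVec h
    simpa only [Matrix.mulVec_mulVec, hb, Matrix.one_mulVec] using this
  have hirr : M.IsIrreducible := by
    refine { exists_pair_ne := ⟨⊥, ⊤, fun h => ?_⟩, eq_bot_or_eq_top := fun S => ?_ }
    · obtain ⟨v, hv, hv0⟩ := Submodule.exists_mem_ne_zero_of_ne_bot hV0
      have hmem : b.conjTranspose.mulVec v ∈ (⊤ : Subrepresentation M).toSubmodule :=
        Submodule.mem_top
      rw [← h] at hmem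
      have h0 : b.conjTranspose.mulVec v = 0 := hmem
      have := hVb v hv
      rw [h0, Matrix.mulVec_zero] at this
      exact hv0 this.symm
    · by_cases hS : S.toSubmodule = ⊥
      · exact Or.inl (Subrepresentation.toSubmodule_injective hS)
      refine Or.inr (Subrepresentation.toSubmodule_injective ?_)
      have hle : S.toSubmodule.map b.mulVecLin ≤ V := by
        rintro _ ⟨w, -, rfl⟩
        exact hbV w
      have hmem : S.toSubmodule.map b.mulVecLin ∈
          {V | V ≠ ⊥ ∧ (∀ g, ∀ v ∈ V, (R g).mulVec v ∈ V) ∧ V ≤ K} := by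
        refine ⟨?_, ?_, hle.trans hVK⟩
        · obtain ⟨w, hw, hw0⟩ := Submodule.exists_mem_ne_zero_of_ne_bot hS
          intro h
          have : b.mulVecLin w ∈ (⊥ : Submodule ℂ (X → ℂ)) := h ▸ Submodule.mem_map_of_mem hw
          refine hw0 (hbinj _ _ ?_)
          rw [Matrix.mulVec_zero]
          exact this
        · rintro g _ ⟨w, hw, rfl⟩
          exact ⟨M g w, S.apply_mem_toSubmodule g hw, hMv g w⟩
      have heq : S.toSubmodule.map b.mulVecLin = V :=
        (lt_or_eq_of_le hle).resolve_left (hmin _ hmem)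
      refine eq_top_iff.2 fun w _ => ?_
      have hw : b.mulVec w ∈ S.toSubmodule.map b.mulVecLin := heq ▸ hbV w
      obtain ⟨w', hw', h⟩ := hw
      rw [← hbinj _ _ h]
      exact hw'
  refine ⟨⟨k, M, hirr, b, hb, fun g => ?_⟩, fun w => hVK (hbV w)⟩
  rw [← hint]
  congr 1
  exact (LinearMap.toMatrix'_toLin' _).symm

/-- Pairwise orthogonal irreducible constituents. -/
def OrthogonalFrames {n : ℕ} (F : Fin n → IrrepFrame R) : Prop :=
  ∀ i j, i ≠ j → (F i).mat.conjTranspose * (F j).mat = 0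

lemma OrthogonalFrames.le_card {n : ℕ} {F : Fin n → IrrepFrame R} (hF : OrthogonalFrames F) :
    n ≤ Fintype.card X := by
  -- the first columns of the constituents are orthonormal
  let A : Matrix X (Fin n) ℂ := Matrix.of fun x i => (F i).mat x ⟨0, (F i).k_pos⟩
  have hA : A.conjTranspose * A = 1 := by
    ext i j
    have hij : (A.conjTranspose * A) i j =
        ((F i).mat.conjTranspose * (F j).mat) ⟨0, (F i).k_pos⟩ ⟨0, (F j).k_pos⟩ := rfl
    rw [hij]
    by_cases h : i = j
    · subst h
      rw [(F i).isometry]; simp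
    · rw [hF i j h]; simp [h]
  have h1 : (1 : Matrix (Fin n) (Fin n) ℂ).rank ≤ Fintype.card X := by
    rw [← hA]
    exact (Matrix.rank_mul_le_right _ _).trans (Matrix.rank_le_card_height A)
  simpa [Matrix.rank_one] using h1

/-- A unitary representation is an orthogonal sum of irreducible constituents: a maximal orthogonal
family has no nonzero vector in its orthogonal complement. -/
lemma exists_orthogonalFrames (hR : ∀ g, (R g).conjTranspose = R g⁻¹) :
    ∃ (n : ℕ) (F : Fin n → IrrepFrame R), OrthogonalFrames F ∧
      ∀ v, (∀ i, (F i).mat.conjTranspose.mulVec v = 0) → v = 0 := by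
  classical
  let P : ℕ → Prop := fun n => ∃ F : Fin n → IrrepFrame R, OrthogonalFrames F
  have hP0 : P 0 := ⟨Fin.elim0, fun i => i.elim0⟩
  have hbound : ∀ n, P n → n ≤ Fintype.card X := fun n ⟨F, hF⟩ => hF.le_card
  -- a family of maximal length; a vector orthogonal to it would allow one more constituent
  have hN : P (Nat.findGreatest P (Fintype.card X)) :=
    Nat.findGreatest_spec (Nat.zero_le _) hP0
  set n := Nat.findGreatest P (Fintype.card X) with hn
  obtain ⟨F, hF⟩ := hN
  refine ⟨n, F, hF, ?_⟩
  by_contra! hv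
  obtain ⟨v, hv, hv0⟩ := hv
  let K : Submodule ℂ (X → ℂ) := ⨅ i, LinearMap.ker (F i).mat.conjTranspose.mulVecLin
  have hmemK : ∀ v, v ∈ K ↔ ∀ i, (F i).mat.conjTranspose.mulVec v = 0 := fun v => by
    simp [K]
  have hK : K ≠ ⊥ := fun h => hv0 ((Submodule.mem_bot ℂ).1 (h ▸ (hmemK v).2 hv))
  obtain ⟨E, hE⟩ := exists_irrepFrame (R := R) hK <| by
    intro g w hw
    rw [hmemK] at hw ⊢
    intro i
    have h : (F i).mat.conjTranspose * R g =
        (LinearMap.toMatrix' ((F i).irrep g⁻¹)).conjTranspose * (F i).mat.conjTranspose := by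
      rw [← Matrix.conjTranspose_mul, ← (F i).intertwines, Matrix.conjTranspose_mul, hR, inv_inv]
    rw [Matrix.mulVec_mulVec, h, ← Matrix.mulVec_mulVec, hw i, Matrix.mulVec_zero]
  have hFE : ∀ i, (F i).mat.conjTranspose * E.mat = 0 := by
    intro i
    refine Matrix.toLin'.injective (LinearMap.ext fun w => ?_)
    rw [Matrix.toLin'_apply, ← Matrix.mulVec_mulVec, (hmemK _).1 (hE w) i]
    simp
  have hP1 : P (n + 1) := by
    refine ⟨Fin.cons E F, fun i j => ?_⟩
    refine Fin.cases ?_ (fun i => ?_) i <;> refine Fin.cases ?_ (fun j => ?_) j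
    · exact fun h => absurd rfl h
    · intro _
      change E.mat.conjTranspose * (F j).mat = 0
      have := congrArg Matrix.conjTranspose (hFE j)
      rwa [Matrix.conjTranspose_mul, Matrix.conjTranspose_conjTranspose,
        Matrix.conjTranspose_zero] at this
    · intro _
      exact hFE i
    · intro h
      exact hF i j fun h' => h (h' ▸ rfl)
  have := Nat.le_findGreatest (hbound _ hP1) hP1
  omega

/-- An irreducible constituent can be rewritten in the coordinates of an equivalent one: the given
equivalence intertwines two unitary representations, hence is unitary up to a positive scalar by
Schur's lemma. -/
lemma IrrepFrame.exists_transport (hR : ∀ g, (R g).conjTranspose = R g⁻¹) (E F : IrrepFrame R)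
    (φ : E.irrep.Equiv F.irrep) :
    ∃ c : Matrix X (Fin E.k) ℂ, c.conjTranspose * c = 1 ∧
      (∀ g, R g * c = c * LinearMap.toMatrix' (E.irrep g)) ∧
      (∃ Ψ : Matrix (Fin F.k) (Fin E.k) ℂ, c = F.mat * Ψ) ∧
      ∃ Ψ : Matrix (Fin E.k) (Fin F.k) ℂ, F.mat = c * Ψ := by
  let Φ : Matrix (Fin F.k) (Fin E.k) ℂ := LinearMap.toMatrix' φ.toIntertwiningMap.toLinearMap
  let Φ' : Matrix (Fin E.k) (Fin F.k) ℂ := LinearMap.toMatrix' φ.symm.toIntertwiningMap.toLinearMap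
  have hΦ' : Φ * Φ' = 1 := by
    rw [← LinearMap.toMatrix'_comp, ← LinearMap.toMatrix'_id]
    exact congrArg _ (LinearMap.ext fun w => φ.apply_symm_apply w)
  have hΦ : Φ' * Φ = 1 := by
    rw [← LinearMap.toMatrix'_comp, ← LinearMap.toMatrix'_id]
    exact congrArg _ (LinearMap.ext fun w => φ.symm_apply_apply w)
  have hint : ∀ g, Φ * LinearMap.toMatrix' (E.irrep g) = LinearMap.toMatrix' (F.irrep g) * Φ := by
    intro g
    rw [← LinearMap.toMatrix'_comp, ← LinearMap.toMatrix'_comp,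
      φ.toIntertwiningMap.isIntertwining']
  have hR' : ∀ g, R g * (F.mat * Φ) = F.mat * Φ * LinearMap.toMatrix' (E.irrep g) := by
    intro g
    rw [← Matrix.mul_assoc, F.intertwines, Matrix.mul_assoc, ← hint, Matrix.mul_assoc]
  have hunit : ∀ g, (LinearMap.toMatrix' (E.irrep g⁻¹)).conjTranspose =
      LinearMap.toMatrix' (E.irrep g) := by
    have h : ∀ g, LinearMap.toMatrix' (E.irrep g) = E.mat.conjTranspose * R g * E.mat := by
      intro g
      rw [Matrix.mul_assoc, E.intertwines, ← Matrix.mul_assoc, E.isometry, Matrix.one_mul]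
    intro g
    rw [h, h, Matrix.conjTranspose_mul, Matrix.conjTranspose_mul, hR, inv_inv,
      Matrix.conjTranspose_conjTranspose, Matrix.mul_assoc]
  have hgram : (F.mat * Φ).conjTranspose * (F.mat * Φ) = Φ.conjTranspose * Φ := by
    rw [Matrix.conjTranspose_mul, Matrix.mul_assoc, ← Matrix.mul_assoc _ F.mat, F.isometry,
      Matrix.one_mul]
  have hcomm : ∀ g, Φ.conjTranspose * Φ * LinearMap.toMatrix' (E.irrep g) =
      LinearMap.toMatrix' (E.irrep g) * (Φ.conjTranspose * Φ) := by
    intro g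
    rw [← hgram, Matrix.mul_assoc, ← hR', ← hunit g, ← Matrix.mul_assoc,
      ← Matrix.mul_assoc (LinearMap.toMatrix' _).conjTranspose, ← Matrix.conjTranspose_mul, ← hR',
      Matrix.conjTranspose_mul (R g⁻¹), hR, inv_inv]
  have := E.irreducible
  obtain ⟨z, hz⟩ :=
    (Representation.IsIrreducible.algebraMap_intertwiningMap_bijective_of_isAlgClosed
    (ρ := E.irrep)).2 ⟨Matrix.toLin' (Φ.conjTranspose * Φ), fun g => by
      apply LinearMap.toMatrix'.injective
      rw [LinearMap.toMatrix'_comp, LinearMap.toMatrix'_comp, LinearMap.toMatrix'_toLin', hcomm]⟩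
  have hz : Φ.conjTranspose * Φ = z • 1 := by
    have h := congrArg (fun f => LinearMap.toMatrix' f.toLinearMap) hz
    simp only [LinearMap.toMatrix'_toLin'] at h
    rw [← h, ← LinearMap.toMatrix'_one, ← map_smul]
    rfl
  have hpos : 0 < z := by
    have hps := Matrix.posSemidef_conjTranspose_mul_self Φ
    have h0 : 0 ≤ z := by
      have := hps.diag_nonneg (i := ⟨0, E.k_pos⟩)
      rw [hz] at this
      simpa using this
    refine lt_of_le_of_ne h0 fun h => ?_
    rw [← h, zero_smul, Matrix.conjTranspose_mul_self_eq_zero] at hz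
    rw [hz, Matrix.mul_zero] at hΦ
    have := congrFun (congrFun hΦ ⟨0, E.k_pos⟩) ⟨0, E.k_pos⟩
    simp at this
  -- the Gram matrix of `F.mat * Φ` is `z • 1`; division by `s = √z` makes the columns orthonormal
  obtain ⟨s, hs, rfl⟩ : ∃ s : ℝ, 0 < s ∧ (s : ℂ) ^ 2 = z := by
    have hz1 := Complex.pos_iff.1 hpos
    refine ⟨Real.sqrt z.re, Real.sqrt_pos.2 hz1.1, ?_⟩
    rw [← Complex.ofReal_pow, Real.sq_sqrt hz1.1.le]
    exact Complex.ext rfl hz1.2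
  have hs' : (s : ℂ) ≠ 0 := by exact_mod_cast hs.ne'
  refine ⟨(s : ℂ)⁻¹ • (F.mat * Φ), ?_, fun g => ?_, ⟨(s : ℂ)⁻¹ • Φ, ?_⟩, ⟨(s : ℂ) • Φ', ?_⟩⟩
  · rw [Matrix.conjTranspose_smul, Matrix.smul_mul, Matrix.mul_smul, hgram, hz, smul_smul,
      smul_smul]
    have : star (s : ℂ)⁻¹ = (s : ℂ)⁻¹ := by
      rw [star_inv₀, RCLike.star_def, Complex.conj_ofReal]
    rw [this]
    have : (s : ℂ)⁻¹ * (s : ℂ)⁻¹ * (s : ℂ) ^ 2 = 1 := by field_simp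
    rw [this, one_smul]
  · rw [Matrix.mul_smul, hR', Matrix.smul_mul]
  · rw [Matrix.mul_smul]
  · rw [Matrix.smul_mul, Matrix.mul_smul, smul_smul, inv_mul_cancel₀ hs', one_smul,
      Matrix.mul_assoc, hΦ', Matrix.mul_one]

end UnitaryDecomposition

section SchurBasisExists

variable {d : ℕ}

/-- `ρ_{O,t}` as a homomorphism into matrices. -/
noncomputable def rhoHom (t : ℕ) (O : Matrix (Fin d) (Fin d) ℂ) :
    SymGroup O →* Matrix (Fin (2 * t + 2) → Fin d) (Fin (2 * t + 2) → Fin d) ℂ where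
  toFun := rhoO t O
  map_one' := by
    rw [← tensorOp_one, rhoO]
    congr 1
    ext1 k
    split_ifs <;> rfl
  map_mul' g h := by
    simp only [rhoO, tensorOp_mul]
    congr 1
    ext1 k
    split_ifs <;> rfl

lemma conjTranspose_rhoHom (t : ℕ) (O : Matrix (Fin d) (Fin d) ℂ) (g : SymGroup O) :
    (rhoHom t O g).conjTranspose = rhoHom t O g⁻¹ := by
  change (rhoO t O g).conjTranspose = rhoO t O g⁻¹
  simp only [rhoO, conjTranspose_tensorOp]
  congr 1
  ext1 k
  split_ifs <;> rfl

/-- The Schur basis is put together from an orthogonal family of irreducible constituents: `I` is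
the set of equivalence classes of the constituents, and every constituent is written in the
coordinates of the chosen representative of its class. -/
theorem nonempty_schurBasis (t : ℕ) (O : Matrix (Fin d) (Fin d) ℂ) :
    Nonempty (SchurBasis t O) := by
  classical
  have hR := conjTranspose_rhoHom t O
  obtain ⟨n, F, hF, hcomplete⟩ := exists_orthogonalFrames hR
  let S : Setoid (Fin n) :=
    { r := fun i j => Nonempty ((F i).irrep.Equiv (F j).irrep)
      iseqv := ⟨fun i => ⟨.refl _⟩, fun ⟨φ⟩ => ⟨φ.symm⟩, fun ⟨φ⟩ ⟨ψ⟩ => ⟨φ.trans ψ⟩⟩ }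
  let I := Quotient S
  let cls : Fin n → I := Quotient.mk S
  let rep : I → Fin n := Quotient.out
  have hrep : ∀ r, cls (rep r) = r := Quotient.out_eq
  let Cls : I → Type := fun r => {i : Fin n // cls i = r}
  have hequiv : ∀ r (i : Cls r), Nonempty ((F (rep r)).irrep.Equiv (F i.1).irrep) := fun r i =>
    Quotient.exact ((hrep r).trans i.2.symm)
  choose c hc1 hc2 hc3 hc4 using fun r (i : Cls r) =>
    IrrepFrame.exists_transport hR (F (rep r)) (F i.1) (hequiv r i).some
  let mult : I → ℕ := fun r => Fintype.card (Cls r)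
  let e : ∀ r, Fin (mult r) ≃ Cls r := fun r => (Fintype.equivFin (Cls r)).symm
  let Q : Matrix (Fin (2 * t + 2) → Fin d) (Σ r, Fin (F (rep r)).k × Fin (mult r)) ℂ :=
    Matrix.of fun x u => c u.1 (e u.1 u.2.2) x u.2.1
  have horth : ∀ r s (i : Cls r) (j : Cls s), i.1 ≠ j.1 → (c r i).conjTranspose * c s j = 0 := by
    intro r s i j hij
    obtain ⟨Ψ, hΨ⟩ := hc3 r i
    obtain ⟨Ψ', hΨ'⟩ := hc3 s j
    rw [hΨ, hΨ', Matrix.conjTranspose_mul, Matrix.mul_assoc, ← Matrix.mul_assoc _ (F j.1).mat,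
      hF _ _ hij, Matrix.zero_mul, Matrix.mul_zero]
  have hentry : ∀ u v, (Q.conjTranspose * Q) u v =
      ((c u.1 (e u.1 u.2.2)).conjTranspose * c v.1 (e v.1 v.2.2)) u.2.1 v.2.1 := fun u v => rfl
  have hQ : Q.conjTranspose * Q = 1 := by
    ext ⟨r, a, α⟩ ⟨s, b, β⟩
    rw [hentry]
    by_cases hrs : r = s
    · subst hrs
      by_cases hαβ : α = β
      · subst hαβ
        simp [hc1, Matrix.one_apply]
      · rw [horth _ _ _ _ fun h => hαβ ((e r).injective (Subtype.ext h))]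
        simp [hαβ]
    · rw [horth _ _ _ _ fun h => hrs ((e r α).2.symm.trans ((congrArg cls h).trans (e s β).2))]
      simp [hrs]
  have hker : ∀ v, Q.conjTranspose.mulVec v = 0 → v = 0 := by
    intro v hv
    refine hcomplete v fun i => ?_
    let i' : Cls (cls i) := ⟨i, rfl⟩
    obtain ⟨Ψ, hΨ⟩ := hc4 (cls i) i'
    have h0 : (c (cls i) i').conjTranspose.mulVec v = 0 := by
      ext a
      have h := congrFun hv ⟨cls i, (a, (e (cls i)).symm i')⟩
      have h' : (Q.conjTranspose.mulVec v) ⟨cls i, (a, (e (cls i)).symm i')⟩ =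
          ((c (cls i) (e (cls i) ((e (cls i)).symm i'))).conjTranspose.mulVec v) a := rfl
      rw [h', Equiv.apply_symm_apply] at h
      exact h
    change (F i'.1).mat.conjTranspose.mulVec v = 0
    rw [hΨ, Matrix.conjTranspose_mul, ← Matrix.mulVec_mulVec, h0, Matrix.mulVec_zero]
  -- `v - Q Qᴴ v` is orthogonal to all columns of `Q`
  have hQ' : Q * Q.conjTranspose = 1 := by
    refine Matrix.toLin'.injective (LinearMap.ext fun v => ?_)
    rw [Matrix.toLin'_apply, Matrix.toLin'_one, LinearMap.id_apply, ← sub_eq_zero]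
    refine hker _ ?_
    rw [Matrix.mulVec_sub, Matrix.mulVec_mulVec, ← Matrix.mul_assoc, hQ, Matrix.one_mul, sub_self]
  have hblock : ∀ g, rhoO t O g * Q = Q * Matrix.blockDiagonal' fun r =>
      LinearMap.toMatrix' ((F (rep r)).irrep g) ⊗ₖ
        (1 : Matrix (Fin (mult r)) (Fin (mult r)) ℂ) := by
    intro g
    ext x ⟨r, a, α⟩
    have h1 : (rhoO t O g * Q) x ⟨r, (a, α)⟩ = (rhoHom t O g * c r (e r α)) x a := rfl
    rw [h1, hc2, Matrix.mul_apply, Matrix.mul_apply, Fintype.sum_sigma, Finset.sum_eq_single r]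
    · simp [Fintype.sum_prod_type, Matrix.blockDiagonal'_apply_eq, Matrix.one_apply, Q]
    · intro s _ hs
      refine Finset.sum_eq_zero fun u _ => ?_
      rw [Matrix.blockDiagonal'_apply_ne _ _ _ hs, mul_zero]
    · simp
  exact ⟨{
    I := I
    fintypeI := inferInstance
    decEqI := inferInstance
    dim := fun r => (F (rep r)).k
    mult := mult
    mult_pos := fun r => Fintype.card_pos_iff.2 ⟨⟨rep r, hrep r⟩⟩
    irrep := fun r => (F (rep r)).irrep
    irreducible := fun r => (F (rep r)).irreducible
    inequivalent := fun r s hrs => ⟨fun φ => hrs <| by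
      rw [← hrep r, ← hrep s]
      exact Quotient.sound ⟨φ⟩⟩
    Q := Q
    conjTranspose_mul_self := hQ
    mul_conjTranspose_self := hQ'
    block := fun g => by
      rw [Matrix.mul_assoc, hblock g, ← Matrix.mul_assoc, hQ, Matrix.one_mul] }⟩

end SchurBasisExists

end ShadowComb

/-! ### Equivalence of the two programs -/

theorem mainTheorem9 (d t : ℕ) (hd : 0 < d) (ht : 0 < t) (O : Matrix (Fin d) (Fin d) ℂ)
    (hO : O.IsHermitian) :
    Nonempty (ShadowComb.SchurBasis t O) ∧
    ∀ (B : ShadowComb.SchurBasis t O) (σ : Equiv.Perm (Fin (2 * t + 2))),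
      ShadowComb.IsGrouping σ →
      Set.BijOn (B.assemble σ) {c | B.ReducedFeasible σ c}
        {C | ShadowComb.Feasible C ∧ ShadowComb.Symmetric O C} ∧
      (∀ c : B.Blocks,
        (B.assemble σ c).trace = ∑ r, (B.dim r : ℂ) * (c r).trace ∧
        ShadowComb.objective O (B.assemble σ c) = B.reducedObjective σ c) ∧
      (∀ C : ShadowComb.CombOp d t, ShadowComb.Feasible C →
        ∃ C' : ShadowComb.CombOp d t, ShadowComb.Feasible C' ∧ ShadowComb.Symmetric O C' ∧
          ShadowComb.objective O C' ≤ ShadowComb.objective O C) ∧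
      ∃ m : ℝ,
        IsLeast (ShadowComb.objective O '' {C : ShadowComb.CombOp d t | ShadowComb.Feasible C}) m ∧
        IsLeast (B.reducedObjective σ '' {c | B.ReducedFeasible σ c}) m := by
  refine ⟨ShadowComb.nonempty_schurBasis t O, fun B σ hσ => ⟨⟨?_, ?_, ?_⟩, fun c =>
    ⟨B.trace_assemble σ c, B.objective_assemble σ c⟩,
    fun C hC => ShadowComb.exists_symmetric_le O hC, ?_⟩⟩
  · exact fun c hc => ⟨(B.feasible_assemble_iff σ c).2 hc, B.symmetric_assemble hσ c⟩
  · exact (B.assemble_injective σ).injOn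
  · rintro C ⟨hC, hCs⟩
    obtain ⟨c, rfl⟩ := B.exists_assemble_eq hσ hCs
    exact ⟨c, (B.feasible_assemble_iff σ c).1 hC, rfl⟩
  · obtain ⟨C₀, hC₀, hmin⟩ := ShadowComb.isCompact_feasible.exists_isMinOn
      (ShadowComb.exists_feasible (t := t) hd) (ShadowComb.continuous_objective O).continuousOn
    refine ⟨ShadowComb.objective O C₀, ⟨⟨C₀, hC₀, rfl⟩, ?_⟩, ?_, ?_⟩
    · rintro _ ⟨C, hC, rfl⟩
      exact hmin hC
    · obtain ⟨C, hC, hCs, hle⟩ := ShadowComb.exists_symmetric_le O hC₀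
      obtain ⟨c, rfl⟩ := B.exists_assemble_eq hσ hCs
      refine ⟨c, (B.feasible_assemble_iff σ c).1 hC, ?_⟩
      rw [← B.objective_assemble]
      exact le_antisymm hle (hmin hC)
    · rintro _ ⟨c, hc, rfl⟩
      rw [← B.objective_assemble]
      exact hmin ((B.feasible_assemble_iff σ c).2 hc)
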